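/- Let $\mathcal H$ (state space) and $\mathcal V$ (control space) be real Hilbert spaces with scalar products $(\cdot,\cdot)$, and let $\gamma,b,\nu,M,\nu_T,M_T,m,k$ be real constants. Assume the following. (i) $A:\mathcal H\to\mathcal H$ is $C^1$ with $A(0)=0$, $DA$ is differentiable, and for all $x,x_1,x_2\in\mathcal H$ $$\|DA(x)\|\le\gamma,\qquad \|DA(x_1)-DA(x_2)\|\le\frac{b\,|x_1-x_2|}{1+\max(|x_1|,|x_2|)}.$$ (ii) $F,F_T:\mathcal H\to\mathbb R$ are $C^2$, $F(0)=F_T(0)=0$, $DF(0)=DF_T(0)=0$, $\nu,\nu_T>0$, and for all $x,\xi\in\mathcal H$ $$\nu|\xi|^2\le(D^2F(x)\xi,\xi)\le M|\xi|^2,\qquad \nu_T|\xi|^2\le(D^2F_T(x)\xi,\xi)\le M_T|\xi|^2.$$ (iii) $B:\mathcal V\to\mathcal H$ is bounded and linear, $N:\mathcal V\to\mathcal V$ is a bounded, self-adjoint, nonnegative operator with a bounded inverse, and $(BN^{-1}B^*\xi,\xi)\ge m|\xi|^2$ for all $\xi\in\mathcal H$, with $m>0$. (iv) $0<k<\min(m,\nu)$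 and $\dfrac{b^2}{16}<(m-k)(\nu-k)$. (v) $\nu-b\alpha_0>0$, where $\alpha_t=\dfrac{M_T^2}{\nu_T}+\dfrac{\gamma^2+M^2}{k}(T-t)$. (vi) $\gamma^2<M\,\|BN^{-1}B^*\|$. Let $0\le t\le T$ and $x\in\mathcal H$. For each control $v\in L^2(t,T;\mathcal V)$ the state equation $$\frac{dx}{ds}=A(x(s))+Bv(s),\qquad x(t)=x,$$ has exactly one solution $x(\cdot)\in H^1(t,T;\mathcal H)$, and we set $$J_{xt}(v)=\int_t^TF(x(s))\,ds+F_T(x(T))+\frac12\int_t^T(v(s),Nv(s))\,ds .$$ The forward-backward system $$\frac{dy}{ds}=A(y)-BN^{-1}B^*z,\qquad -\frac{dz}{ds}=(DA(y))^*z+DF(y),\quad t<s<T,\qquad y(t)=x,\quad z(T)=DF_T(y(T)),$$ has exactly one solution $(y,z)$ on $[t,T]$, and the control $$u(s)=-N^{-1}B^*z(s)$$ is the unique optimal control: $u\in L^2(t,T;\mathcal V)$, $J_{xt}(u)\le J_{xt}(v)$ for every $v\in L^2(t,T;\mathcal V)$, and every $v\in L^2(t,T;\mathcal V)$ that minimizes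 $J_{xt}$ equals $u$ almost everywhere on $(t,T)$. -/

import Mathlib

open MeasureTheory Set
open scoped InnerProductSpace ENNReal

namespace HilbertControl

noncomputable section

variable {H V : Type*}
  [NormedAddCommGroup H] [InnerProductSpace ℝ H] [CompleteSpace H]
  [NormedAddCommGroup V] [InnerProductSpace ℝ V] [CompleteSpace V]

/-- The bounded operator `B N⁻¹ B*` on the state space. -/
def gain (B : V →L[ℝ] H) (N : V ≃L[ℝ] V) : H →L[ℝ] H :=
  B ∘L (N.symm : V →L[ℝ] V) ∘L ContinuousLinearMap.adjoint B

/-- The function `α_t = M_T² / ν_T + (γ² + M²) / k * (T - t)`. -/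
def alpha (γ M νT MT k T t : ℝ) : ℝ :=
  MT ^ 2 / νT + (γ ^ 2 + M ^ 2) / k * (T - t)

/-- `v` belongs to `L²(t, T; V)`. Controls are represented by functions; two functions are the
same control when they agree almost everywhere on `(t, T)`. -/
def IsControl (t T : ℝ) (v : ℝ → V) : Prop :=
  MemLp v 2 (volume.restrict (Ioc t T))

/-- `ξ` solves `dξ/ds = A(ξ) + B v(s)` on `[t, T]` with `ξ(t) = x`, in the absolutely continuous
sense: for `v` in `L²(t, T; V)` the integrand below is in `L²(t, T; H)`, so that the
equation says that `ξ` is in `H¹(t, T; H)` with this weak derivative and initial value `x`. -/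
def IsState (A : H → H) (B : V →L[ℝ] H) (t T : ℝ) (x : H) (v : ℝ → V) (ξ : ℝ → H) : Prop :=
  ContinuousOn ξ (Icc t T) ∧
    ∀ s ∈ Icc t T, ξ s = x + ∫ τ in t..s, (A (ξ τ) + B (v τ))

/-- The state driven by the control `v` from `x` at time `t`: a chosen solution of the state
equation (for a globally Lipschitz `A` a solution exists and is unique on `[t, T]`). -/
def state (A : H → H) (B : V →L[ℝ] H) (t T : ℝ) (x : H) (v : ℝ → V) : ℝ → H :=
  Classical.epsilon fun ξ : ℝ → H => IsState A B t T x v ξ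

/-- The payoff functional `J_{xt}(v)`. -/
def payoff (A : H → H) (B : V →L[ℝ] H) (N : V ≃L[ℝ] V) (F FT : H → ℝ) (t T : ℝ) (x : H)
    (v : ℝ → V) : ℝ :=
  (∫ s in t..T, F (state A B t T x v s)) + FT (state A B t T x v T)
    + 1 / 2 * ∫ s in t..T, ⟪v s, N (v s)⟫_ℝ

/-- `u` is an optimal control: it minimizes `J_{xt}` over `L²(t, T; V)`. -/
def IsOptimalControl (A : H → H) (B : V →L[ℝ] H) (N : V ≃L[ℝ] V) (F FT : H → ℝ) (t T : ℝ) (x : H)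
    (u : ℝ → V) : Prop :=
  IsControl t T u ∧
    ∀ v : ℝ → V, IsControl t T v → payoff A B N F FT t T x u ≤ payoff A B N F FT t T x v

/-- `(y, z)` is a solution on `[t, T]` of the forward-backward system
`dy/ds = A(y) - B N⁻¹ B* z`, `-dz/ds = (DA(y))* z + DF(y)`, `y(t) = x`, `z(T) = DF_T(y(T))`. -/
structure IsFBSolution (A : H → H) (B : V →L[ℝ] H) (N : V ≃L[ℝ] V) (F FT : H → ℝ) (t T : ℝ) (x : H)
    (y z : ℝ → H) : Prop where
  continuousOn_y : ContinuousOn y (Icc t T)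
  continuousOn_z : ContinuousOn z (Icc t T)
  forward : ∀ s ∈ Ioo t T, HasDerivAt y (A (y s) - gain B N (z s)) s
  backward : ∀ s ∈ Ioo t T, HasDerivAt z
    (-(ContinuousLinearMap.adjoint (fderiv ℝ A (y s)) (z s) + gradient F (y s))) s
  initial : y t = x
  terminal : z T = gradient FT (y T)

/-- The control `u(s) = -N⁻¹ B* z(s)`. -/
def feedback (B : V →L[ℝ] H) (N : V ≃L[ℝ] V) (z : ℝ → H) : ℝ → V :=
  fun s => -N.symm (ContinuousLinearMap.adjoint B (z s))

end

end HilbertControl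

/-!
The proof rests on two facts about a solution `(y, z)` of the forward-backward system.

*Growth of the costate.* Along a solution, `⟪y, z⟫` decreases at rate at least `k (|y|² + |z|²)`
(`Hypotheses.dissipation`): the only indefinite term is `⟪A(y) - DA(y) y, z⟫ ≤ (b / 2) |y| |z|`,
and `b² / 16 < (m - k) (ν - k)` says that the other terms dominate it. At the final time,
`⟪y, z⟫ ≥ νT |y|²`. A general energy estimate, `norm_le_alpha_mul_norm`, turns this into
`|z| ≤ a |y|` on the whole interval, with `a = alpha γ M νT MT k T 0`.

*Differences of solutions.* The second-order remainders of `A` that appear when the same computation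
is carried out for two solutions are at most `(b / 2) |y₁ - y₂|² |z| / (1 + |y|)`, and by the first
fact `|z| / (1 + |y|) ≤ a`. Since `b a < ν`, the difference of two solutions dissipates as well
(`Hypotheses.dissipation_sub`). This gives uniqueness (`IsFBSolution.unique`), and the same energy
estimate gives `|z₁ - z₂| ≤ L |y₁ - y₂|` with a constant `L` that depends on the data only
(`IsFBSolution.norm_costate_sub_le`).

*Existence* is by shooting from the final time. For every terminal state `p` the system with
`y(T) = p`, `z(T) = DF_T(p)` is an ordinary differential equation of linear growth and is solved
on `[0, T]` (`exists_isFBSolution_terminal`). It remains to see that `p ↦ y(s)` is onto for each `s`.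
This holds for `s = T`. If it holds at `s'` and `s < s'` is within a fixed distance of `s'`, then by
the Lipschitz bound `L` the map `y(s') ↦ y(s)` differs from the identity by a contraction, so that it
is onto by Banach's fixed point theorem, and surjectivity passes from `s'` to `s`
(`exists_isFBSolution_through`).

*Optimality.* For a control `v` with state `ξ`, integration by parts of `⟪z, ξ - y⟫` removes the
first-order terms of `J(v) - J(u)`. The remainder of `A` is at most `(b a / 2) |ξ - y|²` and is
absorbed by the convexity of `F`. Hence `J(v) ≥ J(u) + (1 / 2) ∫ ⟪v - u, N (v - u)⟫`
(`IsFBSolution.payoff_feedback_add_le`), which contains both the optimality of `u` and its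
uniqueness.
-/

namespace HilbertControl

/-! ### Volterra equations with a Lipschitz nonlinearity -/

section Volterra

open scoped NNReal

variable {E : Type*} [NormedAddCommGroup E] [NormedSpace ℝ E]

/-- The Volterra operator `ξ ↦ g + ∫ₐ f(ξ)` on `C([a, b], E)`. -/
noncomputable def volterraMap {a b : ℝ} (hab : a ≤ b) {f : E → E} (hf : Continuous f)
    (g : C(Icc a b, E)) (ξ : C(Icc a b, E)) : C(Icc a b, E) where
  toFun s := g s + ∫ τ in a..(s : ℝ), f (IccExtend hab ξ τ)
  continuous_toFun := by
    have hc : Continuous fun τ => f (IccExtend hab ξ τ) := hf.comp ξ.continuous.Icc_extend'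
    exact g.continuous.add
      ((intervalIntegral.continuous_primitive (fun _ _ => hc.intervalIntegrable _ _) a).comp
        continuous_subtype_val)

/-- The iterates of the Volterra operator contract like the terms of the exponential series. -/
theorem norm_iterate_volterraMap_sub_le {a b : ℝ} (hab : a ≤ b) {f : E → E} {K : ℝ≥0}
    (hf : LipschitzWith K f) (g ξ η : C(Icc a b, E)) (n : ℕ) (s : Icc a b) :
    ‖(volterraMap hab hf.continuous g)^[n] ξ s - (volterraMap hab hf.continuous g)^[n] η s‖
      ≤ (K * (s - a)) ^ n / n.factorial * dist ξ η := by
  induction n generalizing s with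
  | zero => simpa [dist_eq_norm] using ContinuousMap.dist_apply_le_dist (f := ξ) (g := η) s
  | succ n ih =>
    simp only [Function.iterate_succ', Function.comp_apply]
    set ξn := (volterraMap hab hf.continuous g)^[n] ξ
    set ηn := (volterraMap hab hf.continuous g)^[n] η
    have hc (ζ : C(Icc a b, E)) : Continuous fun τ => f (IccExtend hab ζ τ) :=
      hf.continuous.comp ζ.continuous.Icc_extend'
    have e : volterraMap hab hf.continuous g ξn s - volterraMap hab hf.continuous g ηn s
        = ∫ τ in a..(s : ℝ), (f (IccExtend hab ξn τ) - f (IccExtend hab ηn τ)) := by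
      rw [intervalIntegral.integral_sub ((hc _).intervalIntegrable _ _)
        ((hc _).intervalIntegrable _ _)]
      simp [volterraMap]
    rw [e]
    have h1 : ‖∫ τ in a..(s : ℝ), (f (IccExtend hab ξn τ) - f (IccExtend hab ηn τ))‖
        ≤ ∫ τ in a..(s : ℝ), (K * ((K * (τ - a)) ^ n / n.factorial * dist ξ η)) := by
      refine intervalIntegral.norm_integral_le_of_norm_le s.2.1 ?_ ?_
      · refine Filter.Eventually.of_forall fun τ hτ => ?_
        have hτ' : τ ∈ Icc a b := ⟨hτ.1.le, hτ.2.trans s.2.2⟩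
        rw [IccExtend_of_mem _ _ hτ', IccExtend_of_mem _ _ hτ']
        exact (hf.norm_sub_le _ _).trans
          (mul_le_mul_of_nonneg_left (ih ⟨τ, hτ'⟩) K.coe_nonneg)
      · exact Continuous.intervalIntegrable (by fun_prop) _ _
    refine h1.trans (le_of_eq ?_)
    have e2 : ∀ τ : ℝ, (K : ℝ) * ((K * (τ - a)) ^ n / n.factorial * dist ξ η)
        = (K ^ (n + 1) / n.factorial * dist ξ η) * (τ - a) ^ n := by
      intro τ; rw [mul_pow]; ring
    simp_rw [e2]
    rw [intervalIntegral.integral_const_mul,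
      intervalIntegral.integral_comp_sub_right (fun τ => τ ^ n) a, integral_pow]
    rw [Nat.factorial_succ, mul_pow]
    push_cast
    have : (n.factorial : ℝ) ≠ 0 := by positivity
    have : (n + 1 : ℝ) ≠ 0 := by positivity
    field_simp
    simp

/-- An integral equation `ξ(s) = g(s) + ∫ₐˢ f(ξ)` with a globally Lipschitz nonlinearity has
exactly one continuous solution on the whole interval: an iterate of the Volterra operator is a
contraction. -/
theorem exists_unique_volterra [CompleteSpace E] {a b : ℝ} (hab : a ≤ b) {f : E → E} {K : ℝ≥0}
    (hf : LipschitzWith K f) {g : ℝ → E} (hg : ContinuousOn g (Icc a b)) :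
    ∃ ξ : ℝ → E, (Continuous ξ ∧ ∀ s ∈ Icc a b, ξ s = g s + ∫ τ in a..s, f (ξ τ)) ∧
      ∀ ξ' : ℝ → E, ContinuousOn ξ' (Icc a b) →
        (∀ s ∈ Icc a b, ξ' s = g s + ∫ τ in a..s, f (ξ' τ)) → EqOn ξ' ξ (Icc a b) := by
  let G : C(Icc a b, E) := ⟨(Icc a b).domRestrict g, hg.domRestrict⟩
  let Φ := volterraMap hab hf.continuous G
  obtain ⟨n, hn⟩ : ∃ n : ℕ, (K * (b - a)) ^ n / n.factorial < 1 :=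
    ((FloorSemiring.tendsto_pow_div_factorial_atTop ((K : ℝ) * (b - a))).eventually
      (gt_mem_nhds one_pos)).exists
  have hnn : 0 ≤ (K * (b - a)) ^ n / n.factorial := by
    have : 0 ≤ b - a := sub_nonneg.2 hab
    positivity
  obtain ⟨C, hC⟩ : ∃ C : ℝ≥0, (C : ℝ) = (K * (b - a)) ^ n / n.factorial := ⟨⟨_, hnn⟩, rfl⟩
  have hcontr : ContractingWith C Φ^[n] := by
    refine ⟨by rw [← hC] at hn; exact_mod_cast hn, LipschitzWith.of_dist_le_mul fun ξ η => ?_⟩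
    rw [ContinuousMap.dist_le (by positivity)]
    intro s
    rw [dist_eq_norm]
    refine (norm_iterate_volterraMap_sub_le hab hf G ξ η n s).trans ?_
    have h1 : 0 ≤ (s : ℝ) - a := sub_nonneg.2 s.2.1
    have h2 : (s : ℝ) ≤ b := s.2.2
    rw [hC]
    gcongr
  have : Nonempty C(Icc a b, E) := ⟨G⟩
  have key (ξ' : ℝ → E) (hc : ContinuousOn ξ' (Icc a b))
      (h : ∀ s ∈ Icc a b, ξ' s = g s + ∫ τ in a..s, f (ξ' τ)) :
      Function.IsFixedPt Φ ⟨(Icc a b).domRestrict ξ', hc.domRestrict⟩ := by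
    ext s
    change g s + ∫ τ in a..(s : ℝ), f (IccExtend hab ((Icc a b).domRestrict ξ') τ) = ξ' s
    rw [h s s.2]
    congr 1
    refine intervalIntegral.integral_congr fun τ hτ => ?_
    rw [uIcc_of_le s.2.1] at hτ
    have hτ' : τ ∈ Icc a b := ⟨hτ.1, hτ.2.trans s.2.2⟩
    simp only [IccExtend_of_mem _ _ hτ']
    rfl
  have hfix : Function.IsFixedPt Φ (ContractingWith.fixedPoint _ hcontr) :=
    ContractingWith.isFixedPt_fixedPoint_iterate hcontr
  set ξ₀ := ContractingWith.fixedPoint _ hcontr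
  refine ⟨IccExtend hab ξ₀, ⟨ξ₀.continuous.Icc_extend', fun s hs => ?_⟩, fun ξ' hc h s hs => ?_⟩
  · rw [IccExtend_of_mem _ _ hs]
    conv_lhs => rw [← hfix]
    rfl
  · have := hcontr.fixedPoint_unique ((key ξ' hc h).iterate n)
    have := DFunLike.congr_fun this ⟨s, hs⟩
    rw [IccExtend_of_mem _ _ hs]
    exact this

end Volterra

/-! ### Integration by parts -/

section ByParts

variable {H : Type*} [NormedAddCommGroup H] [InnerProductSpace ℝ H] [CompleteSpace H]

/-- Integration by parts for the pairing of a `C¹` function `z` with the primitive of an integrable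
function `g`, by Fubini's theorem on a triangle. -/
theorem integral_inner_primitive {a b : ℝ} (hab : a ≤ b) {z h g : ℝ → H}
    (hz : ContinuousOn z (Icc a b)) (hh : ContinuousOn h (Icc a b))
    (hd : ∀ s ∈ Ioo a b, HasDerivAt z (h s) s) (hg : IntervalIntegrable g volume a b) :
    ∫ s in a..b, ⟪z s, g s⟫_ℝ
      = ⟪z b, ∫ s in a..b, g s⟫_ℝ - ∫ s in a..b, ⟪h s, ∫ τ in a..s, g τ⟫_ℝ := by
  have hg' : IntegrableOn g (Ioc a b) := (intervalIntegrable_iff_integrableOn_Ioc_of_le hab).1 hg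
  have hhi : IntegrableOn h (Ioc a b) := (hh.integrableOn_Icc).mono_set Ioc_subset_Icc_self
  have hrep : ∀ s ∈ Icc a b, z s = z b - ∫ τ in s..b, h τ := by
    intro s hs
    rw [intervalIntegral.integral_eq_sub_of_hasDerivAt_of_le hs.2
      (hz.mono (Icc_subset_Icc_left hs.1)) (fun τ hτ => hd τ ⟨hs.1.trans_lt hτ.1, hτ.2⟩)]
    · abel
    · exact (intervalIntegrable_iff_integrableOn_Ioc_of_le hs.2).2
        (hhi.mono_set (Ioc_subset_Ioc_left hs.1))
  let F : ℝ → ℝ → ℝ := fun s τ => {p : ℝ × ℝ | p.1 < p.2}.indicator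
    (fun p => ⟪h p.2, g p.1⟫_ℝ) (s, τ)
  have hF : IntegrableOn (Function.uncurry F) (uIoc a b ×ˢ uIoc a b) := by
    rw [uIoc_of_le hab, IntegrableOn, Measure.volume_eq_prod, ← Measure.prod_restrict]
    have h1 : Integrable (fun p : ℝ × ℝ => ⟪g p.1, h p.2⟫_ℝ)
        ((volume.restrict (Ioc a b)).prod (volume.restrict (Ioc a b))) :=
      Integrable.op_fst_snd (op := fun x y : H => ⟪x, y⟫_ℝ) (by fun_prop)
        ⟨1, fun x y => by simpa using norm_inner_le_norm (𝕜 := ℝ) x y⟩ hg' hhi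
    have h2 := h1.indicator (measurableSet_lt measurable_fst measurable_snd)
    refine h2.congr (Filter.Eventually.of_forall fun p => ?_)
    simp only [Function.uncurry, F, indicator, mem_ofPred_eq, real_inner_comm]
  have hswap := intervalIntegral_intervalIntegral_swap hF
  have hL : ∀ s ∈ Icc a b, ∫ τ in a..b, F s τ = ⟪∫ τ in s..b, h τ, g s⟫_ℝ := by
    intro s hs
    have e1 : ∀ τ, F s τ = (Ioi s).indicator (fun τ => ⟪h τ, g s⟫_ℝ) τ := fun τ => by
      simp [F, indicator]
    simp_rw [e1]
    rw [intervalIntegral.integral_of_le hab, setIntegral_indicator measurableSet_Ioi,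
      Ioc_inter_Ioi, max_eq_right hs.1, intervalIntegral.integral_of_le hs.2]
    have := integral_inner (hhi.mono_set (Ioc_subset_Ioc_left hs.1)) (g s) (𝕜 := ℝ)
    rw [real_inner_comm, ← this]
    simp_rw [real_inner_comm]
  have hR : ∀ τ ∈ Icc a b, ∫ s in a..b, F s τ = ⟪h τ, ∫ s in a..τ, g s⟫_ℝ := by
    intro τ hτ
    have e1 : ∀ s, F s τ = (Iio τ).indicator (fun s => ⟪h τ, g s⟫_ℝ) s := fun s => by
      simp [F, indicator]
    simp_rw [e1]
    rw [intervalIntegral.integral_of_le hab, setIntegral_indicator measurableSet_Iio,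
      intervalIntegral.integral_of_le hτ.1]
    have e2 : Ioc a b ∩ Iio τ = Ioo a τ := by
      ext s; constructor
      · rintro ⟨h1, h2⟩; exact ⟨h1.1, h2⟩
      · rintro ⟨h1, h2⟩; exact ⟨⟨h1, h2.le.trans hτ.2⟩, h2⟩
    rw [e2, ← integral_Ioc_eq_integral_Ioo]
    exact integral_inner (hg'.mono_set (Ioc_subset_Ioc_right hτ.2)) (h τ) (𝕜 := ℝ)
  have e3 : ∫ s in a..b, ⟪z s, g s⟫_ℝ
      = ∫ s in a..b, (⟪z b, g s⟫_ℝ - ∫ τ in a..b, F s τ) := by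
    refine intervalIntegral.integral_congr fun s hs => ?_
    rw [uIcc_of_le hab] at hs
    rw [hL s hs, hrep s hs, inner_sub_left]
  have hFi : IntervalIntegrable (fun s => ∫ τ in a..b, F s τ) volume a b := by
    rw [intervalIntegrable_iff_integrableOn_Ioc_of_le hab]
    have h1 := hF
    rw [uIoc_of_le hab, IntegrableOn, Measure.volume_eq_prod, ← Measure.prod_restrict] at h1
    simp_rw [intervalIntegral.integral_of_le hab]
    exact h1.integral_prod_left
  rw [e3, intervalIntegral.integral_sub _ hFi, hswap]
  · congr 1
    · rw [intervalIntegral.integral_of_le hab, intervalIntegral.integral_of_le hab]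
      exact integral_inner hg' (z b) (𝕜 := ℝ)
    · refine intervalIntegral.integral_congr fun s hs => ?_
      rw [uIcc_of_le hab] at hs
      exact hR s hs
  · rw [intervalIntegrable_iff_integrableOn_Ioc_of_le hab]
    exact hg'.const_inner (z b)

end ByParts

/-! ### Second-order Taylor estimates -/

section Taylor

variable {H : Type*} [NormedAddCommGroup H] [InnerProductSpace ℝ H]

theorem norm_sub_sub_fderiv_le {A : H → H} {b : ℝ} (hA1 : ContDiff ℝ 1 A) (hb : 0 ≤ b)
    (hAb : ∀ x₁ x₂, ‖fderiv ℝ A x₁ - fderiv ℝ A x₂‖ ≤ b * ‖x₁ - x₂‖ / (1 + max ‖x₁‖ ‖x₂‖))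
    (x y : H) :
    ‖A x - A y - fderiv ℝ A y (x - y)‖ ≤ b / 2 * ‖x - y‖ ^ 2 / (1 + ‖y‖) := by
  let φ : ℝ → H := fun θ => A (y + θ • (x - y)) - A y - θ • fderiv ℝ A y (x - y)
  have hφ (θ : ℝ) :
      HasDerivAt φ ((fderiv ℝ A (y + θ • (x - y)) - fderiv ℝ A y) (x - y)) θ := by
    have h1 : HasDerivAt (fun θ : ℝ => y + θ • (x - y)) (x - y) θ := by
      simpa using ((hasDerivAt_id θ).smul_const (x - y)).const_add y
    have h2 := ((hA1.differentiable one_ne_zero _).hasFDerivAt).comp_hasDerivAt θ h1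
    have h3 := ((hasDerivAt_id θ).smul_const (fderiv ℝ A y (x - y)))
    have h4 := (h2.sub_const (A y)).sub h3
    rw [one_smul, ← sub_apply] at h4
    exact h4
  set C := b * ‖x - y‖ ^ 2 / (1 + ‖y‖) with hC
  have key := image_norm_le_of_norm_deriv_right_le_deriv_boundary (a := 0) (b := 1) (f := φ)
    (B := fun θ => C * θ ^ 2 / 2) (B' := fun θ => C * θ)
    (fun θ _ => (hφ θ).continuousAt.continuousWithinAt) (fun θ _ => (hφ θ).hasDerivWithinAt)
    (by simp [φ]) (fun θ => by
      have := ((hasDerivAt_pow 2 θ).const_mul C).div_const 2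
      refine this.congr_deriv ?_
      push_cast
      ring) ?_ (right_mem_Icc.2 zero_le_one)
  · have e : φ 1 = A x - A y - fderiv ℝ A y (x - y) := by simp [φ]
    rw [e] at key
    refine key.trans (le_of_eq ?_)
    rw [hC]; ring
  · intro θ hθ
    refine (ContinuousLinearMap.le_opNorm _ _).trans ?_
    have h1 := hAb (y + θ • (x - y)) y
    have h2 : ‖y + θ • (x - y) - y‖ = θ * ‖x - y‖ := by
      rw [add_sub_cancel_left, norm_smul, Real.norm_of_nonneg hθ.1]
    rw [h2] at h1
    have hθ0 := hθ.1
    have h3 : b * (θ * ‖x - y‖) / (1 + max ‖y + θ • (x - y)‖ ‖y‖)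
        ≤ b * (θ * ‖x - y‖) / (1 + ‖y‖) := by
      gcongr
      exact le_max_right _ _
    calc _ ≤ b * (θ * ‖x - y‖) / (1 + ‖y‖) * ‖x - y‖ :=
          mul_le_mul_of_nonneg_right (h1.trans h3) (norm_nonneg _)
      _ = _ := by rw [hC]; ring

end Taylor

section Gradient

variable {H : Type*} [NormedAddCommGroup H] [InnerProductSpace ℝ H] [CompleteSpace H]
  {f : H → ℝ} {μ M : ℝ}

theorem inner_gradient_eq_fderiv (f : H → ℝ) (x ξ : H) : ⟪gradient f x, ξ⟫_ℝ = fderiv ℝ f x ξ := by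
  rw [← toDual_gradient (𝕜 := ℝ), InnerProductSpace.toDual_apply_apply]

theorem hasDerivAt_inner_gradient_line (hf : ContDiff ℝ 2 f) (x v : H) (θ : ℝ) :
    HasDerivAt (fun θ : ℝ => ⟪gradient f (x + θ • v), v⟫_ℝ)
      (fderiv ℝ (fderiv ℝ f) (x + θ • v) v v) θ := by
  simp_rw [inner_gradient_eq_fderiv]
  have h1 : HasDerivAt (fun θ : ℝ => x + θ • v) v θ := by
    simpa using ((hasDerivAt_id θ).smul_const v).const_add x
  have hd : Differentiable ℝ (fderiv ℝ f) :=
    (hf.fderiv_right (m := 1) (by norm_num)).differentiable one_ne_zero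
  have h2 := (hd _).hasFDerivAt.comp_hasDerivAt θ h1
  simpa using h2.clm_apply (hasDerivAt_const θ v)

theorem continuous_gradient (hf : ContDiff ℝ 2 f) : Continuous (gradient f) :=
  (InnerProductSpace.toDual ℝ H).symm.continuous.comp (hf.continuous_fderiv two_ne_zero)

theorem inner_gradient_line_add_le (hf : ContDiff ℝ 2 f)
    (h2 : ∀ x ξ, μ * ‖ξ‖ ^ 2 ≤ fderiv ℝ (fderiv ℝ f) x ξ ξ) (x v : H) {θ : ℝ} (hθ : 0 ≤ θ) :
    ⟪gradient f x, v⟫_ℝ + μ * θ * ‖v‖ ^ 2 ≤ ⟪gradient f (x + θ • v), v⟫_ℝ := by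
  have hd (θ : ℝ) : HasDerivAt (fun θ : ℝ => ⟪gradient f (x + θ • v), v⟫_ℝ - θ * (μ * ‖v‖ ^ 2))
      (fderiv ℝ (fderiv ℝ f) (x + θ • v) v v - 1 * (μ * ‖v‖ ^ 2)) θ :=
    (hasDerivAt_inner_gradient_line hf x v θ).sub ((hasDerivAt_id θ).mul_const _)
  have hmono := monotone_of_deriv_nonneg (fun θ => (hd θ).differentiableAt)
    (fun θ => by rw [(hd θ).deriv]; linarith [h2 (x + θ • v) v])
  have := hmono hθ
  simp only [zero_smul, add_zero, zero_mul, sub_zero] at this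
  linarith

theorem le_inner_gradient_sub (hf : ContDiff ℝ 2 f)
    (h2 : ∀ x ξ, μ * ‖ξ‖ ^ 2 ≤ fderiv ℝ (fderiv ℝ f) x ξ ξ) (x y : H) :
    μ * ‖x - y‖ ^ 2 ≤ ⟪gradient f x - gradient f y, x - y⟫_ℝ := by
  have := inner_gradient_line_add_le hf h2 y (x - y) zero_le_one
  simp only [one_smul, add_sub_cancel, mul_one] at this
  rw [inner_sub_left]
  linarith

theorem add_inner_gradient_add_le (hf : ContDiff ℝ 2 f)
    (h2 : ∀ x ξ, μ * ‖ξ‖ ^ 2 ≤ fderiv ℝ (fderiv ℝ f) x ξ ξ) (x y : H) :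
    f x + ⟪gradient f x, y - x⟫_ℝ + μ / 2 * ‖y - x‖ ^ 2 ≤ f y := by
  set v := y - x
  have hd (θ : ℝ) : HasDerivAt
      (fun θ : ℝ => f (x + θ • v) - θ * ⟪gradient f x, v⟫_ℝ - θ ^ 2 * (μ / 2 * ‖v‖ ^ 2))
      (⟪gradient f (x + θ • v), v⟫_ℝ - 1 * ⟪gradient f x, v⟫_ℝ
        - (2 * θ) * (μ / 2 * ‖v‖ ^ 2)) θ := by
    have h1 : HasDerivAt (fun θ : ℝ => x + θ • v) v θ := by
      simpa using ((hasDerivAt_id θ).smul_const v).const_add x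
    have h3 := (hf.differentiable two_ne_zero (x + θ • v)).hasFDerivAt.comp_hasDerivAt θ h1
    rw [inner_gradient_eq_fderiv f (x + θ • v) v]
    have h4 := (hasDerivAt_pow 2 θ).mul_const (μ / 2 * ‖v‖ ^ 2)
    simp only [Nat.cast_ofNat, Nat.add_one_sub_one, pow_one] at h4
    exact (h3.sub ((hasDerivAt_id θ).mul_const _)).sub h4
  have hmono := monotoneOn_of_deriv_nonneg (convex_Icc (0 : ℝ) 1)
    (fun θ _ => (hd θ).continuousAt.continuousWithinAt)
    (fun θ _ => (hd θ).differentiableAt.differentiableWithinAt)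
    (fun θ hθ => by
      rw [interior_Icc] at hθ
      rw [(hd θ).deriv]
      linarith [inner_gradient_line_add_le hf h2 x v hθ.1.le])
  have := hmono (left_mem_Icc.2 zero_le_one) (right_mem_Icc.2 zero_le_one) zero_le_one
  simp only [zero_smul, add_zero, zero_mul, sub_zero, one_smul, one_mul, one_pow, ne_eq,
    OfNat.ofNat_ne_zero, not_false_eq_true, zero_pow] at this
  have e : x + v = y := by simp [v]
  rw [e] at this
  linarith

/-- A `C²` function whose Hessian form lies between `0` and `M|ξ|²` has an `M`-Lipschitz gradient:
the Hessian is symmetric, so that its norm is controlled by its quadratic form. -/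
theorem norm_gradient_sub_le (hf : ContDiff ℝ 2 f) (hM : 0 ≤ M)
    (h2 : ∀ x ξ, 0 ≤ fderiv ℝ (fderiv ℝ f) x ξ ξ ∧ fderiv ℝ (fderiv ℝ f) x ξ ξ ≤ M * ‖ξ‖ ^ 2)
    (x y : H) : ‖gradient f x - gradient f y‖ ≤ M * ‖x - y‖ := by
  have hsymm (x : H) : IsSymmSndFDerivAt ℝ f x :=
    hf.contDiffAt.isSymmSndFDerivAt (by simp)
  have hd : Differentiable ℝ (fderiv ℝ f) :=
    (hf.fderiv_right (m := 1) (by norm_num)).differentiable one_ne_zero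
  have hnorm (x : H) : ‖fderiv ℝ (fderiv ℝ f) x‖ ≤ M := by
    refine ContinuousLinearMap.opNorm_le_bound₂ _ hM fun ξ η => ?_
    let L : LinearMap.BilinForm ℝ H := LinearMap.mk₂ ℝ (fun ξ η => fderiv ℝ (fderiv ℝ f) x ξ η)
      (by simp) (by simp) (by simp) (by simp)
    have h := LinearMap.BilinForm.apply_sq_le_of_symm L (fun ξ => (h2 x ξ).1)
      ⟨fun ξ η => hsymm x ξ η⟩ ξ η
    simp only [L, LinearMap.mk₂_apply] at h
    rw [Real.norm_eq_abs]
    refine abs_le_of_sq_le_sq (h.trans ?_) (by positivity)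
    calc _ ≤ (M * ‖ξ‖ ^ 2) * (M * ‖η‖ ^ 2) :=
          mul_le_mul (h2 x ξ).2 (h2 x η).2 (h2 x η).1 (by positivity)
      _ = _ := by ring
  have := convex_univ.norm_image_sub_le_of_norm_fderiv_le (𝕜 := ℝ) (f := fderiv ℝ f)
    (fun x _ => hd x) (fun x _ => hnorm x) (mem_univ y) (mem_univ x)
  rwa [← toDual_gradient (𝕜 := ℝ), ← toDual_gradient (𝕜 := ℝ), ← map_sub,
    LinearIsometryEquiv.norm_map] at this

end Gradient

/-! ### The energy method for dissipative pairs -/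

section Energy

variable {H : Type*} [NormedAddCommGroup H] [InnerProductSpace ℝ H]

/-- Energy estimate: if `⟪y, z⟫` decreases at rate at least `c (|y|² + |z|²)`, dominates
`μ |y|²` at the final time, and `|z'| ≤ p |z| + q |y|`, then `z(t)` is bounded by a multiple
of `y(t)`. -/
theorem norm_le_alpha_mul_norm {y z h : ℝ → H} {D' : ℝ → ℝ} {p q μ κ c t T : ℝ}
    (htT : t ≤ T) (hc : 0 < c) (hμ : 0 < μ) (hκ : 0 < κ)
    (hy : ContinuousOn y (Icc t T)) (hz : ContinuousOn z (Icc t T))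
    (hzd : ∀ s ∈ Ioo t T, HasDerivAt z (h s) s)
    (hD : ∀ s ∈ Ioo t T, HasDerivAt (fun s => ⟪y s, z s⟫_ℝ) (D' s) s)
    (hh : ∀ s ∈ Ioo t T, ‖h s‖ ≤ p * ‖z s‖ + q * ‖y s‖)
    (hD' : ∀ s ∈ Ioo t T, D' s ≤ -c * (‖y s‖ ^ 2 + ‖z s‖ ^ 2))
    (hT : μ * ‖y T‖ ^ 2 ≤ ⟪y T, z T⟫_ℝ) (hzT : ‖z T‖ ≤ κ * ‖y T‖) :
    ‖z t‖ ≤ alpha p q μ κ c T t * ‖y t‖ := by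
  set a := alpha p q μ κ c T t with ha
  have hTt : 0 ≤ T - t := sub_nonneg.2 htT
  have ha0 : 0 < a := by
    rw [ha, alpha]
    have : 0 ≤ (p ^ 2 + q ^ 2) / c * (T - t) := by positivity
    have : 0 < κ ^ 2 / μ := by positivity
    linarith
  set e := z t with he
  -- The multiplier `a` and the slope of the last term are those for which Young's inequality
  -- makes `E` nondecreasing and the terminal terms add up to `|e|² / 2`.
  let E : ℝ → ℝ := fun s =>
    ⟪z s, e⟫_ℝ - a / 2 * ⟪y s, z s⟫_ℝ + (p ^ 2 + q ^ 2) / c * ‖e‖ ^ 2 / (2 * a) * s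
  have hE (s) (hs : s ∈ Ioo t T) : HasDerivAt E
      (⟪h s, e⟫_ℝ - a / 2 * D' s + (p ^ 2 + q ^ 2) / c * ‖e‖ ^ 2 / (2 * a) * 1) s := by
    have h1 : HasDerivAt (fun s => ⟪z s, e⟫_ℝ) ⟪h s, e⟫_ℝ s := by
      simpa using (hzd s hs).inner ℝ (hasDerivAt_const s e)
    exact (h1.sub ((hD s hs).const_mul _)).add ((hasDerivAt_id s).const_mul _)
  have hmono : MonotoneOn E (Icc t T) := by
    refine monotoneOn_of_deriv_nonneg (convex_Icc t T) (by fun_prop) ?_ ?_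
    · rw [interior_Icc]
      exact fun s hs => (hE s hs).differentiableAt.differentiableWithinAt
    · rw [interior_Icc]
      intro s hs
      rw [(hE s hs).deriv]
      have h1 : -(‖h s‖ * ‖e‖) ≤ ⟪h s, e⟫_ℝ := (abs_le.1 (abs_real_inner_le_norm _ _)).1
      have h2 := mul_le_mul_of_nonneg_right (hh s hs) (norm_nonneg e)
      have h3 := mul_le_mul_of_nonneg_left (hD' s hs) ha0.le
      have h4 : (a * c * ‖z s‖ ^ 2 / 2 + p ^ 2 / c * ‖e‖ ^ 2 / (2 * a)) - p * ‖z s‖ * ‖e‖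
          = (a * c * ‖z s‖ - p * ‖e‖) ^ 2 / (2 * a * c) := by field_simp; ring
      have h5 : (a * c * ‖y s‖ ^ 2 / 2 + q ^ 2 / c * ‖e‖ ^ 2 / (2 * a)) - q * ‖y s‖ * ‖e‖
          = (a * c * ‖y s‖ - q * ‖e‖) ^ 2 / (2 * a * c) := by field_simp; ring
      have h6 : 0 ≤ (a * c * ‖z s‖ - p * ‖e‖) ^ 2 / (2 * a * c) := by positivity
      have h7 : 0 ≤ (a * c * ‖y s‖ - q * ‖e‖) ^ 2 / (2 * a * c) := by positivity
      have h8 : (p ^ 2 + q ^ 2) / c * ‖e‖ ^ 2 / (2 * a)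
          = p ^ 2 / c * ‖e‖ ^ 2 / (2 * a) + q ^ 2 / c * ‖e‖ ^ 2 / (2 * a) := by ring
      rw [h8]
      linarith
  have h1 := hmono (left_mem_Icc.2 htT) (right_mem_Icc.2 htT) htT
  simp only [E, ← he, real_inner_self_eq_norm_sq] at h1
  have h2 : ⟪z T, e⟫_ℝ ≤ κ * ‖y T‖ * ‖e‖ :=
    (real_inner_le_norm _ _).trans (mul_le_mul_of_nonneg_right hzT (norm_nonneg e))
  have h3 : (a * μ * ‖y T‖ ^ 2 / 2 + κ ^ 2 / μ * ‖e‖ ^ 2 / (2 * a)) - κ * ‖y T‖ * ‖e‖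
      = (a * μ * ‖y T‖ - κ * ‖e‖) ^ 2 / (2 * a * μ) := by field_simp; ring
  have h4 : 0 ≤ (a * μ * ‖y T‖ - κ * ‖e‖) ^ 2 / (2 * a * μ) := by positivity
  have h5 := mul_le_mul_of_nonneg_left hT ha0.le
  have h6 : κ ^ 2 / μ * ‖e‖ ^ 2 / (2 * a) + (p ^ 2 + q ^ 2) / c * ‖e‖ ^ 2 / (2 * a) * (T - t)
      = ‖e‖ ^ 2 / 2 := by
    have : κ ^ 2 / μ * ‖e‖ ^ 2 / (2 * a) + (p ^ 2 + q ^ 2) / c * ‖e‖ ^ 2 / (2 * a) * (T - t)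
      = a * ‖e‖ ^ 2 / (2 * a) := by rw [ha, alpha]; ring
    rw [this]; field_simp
  have h7 : ⟪y t, e⟫_ℝ ≤ ‖y t‖ * ‖e‖ := real_inner_le_norm _ _
  have h8 := mul_le_mul_of_nonneg_left h7 ha0.le
  have h9 : ‖e‖ * ‖e‖ ≤ (a * ‖y t‖) * ‖e‖ := by nlinarith
  rcases (norm_nonneg e).eq_or_lt with h0 | h0
  · rw [← h0]; positivity
  · exact le_of_mul_le_mul_right h9 h0

/-- In the situation of `norm_le_alpha_mul_norm`, a pair with `y(t) = 0` vanishes: `⟪y, z⟫`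
decreases from `0` to a nonnegative value. -/
theorem eq_zero_of_dissipative {y z : ℝ → H} {D' : ℝ → ℝ} {μ κ c t T : ℝ}
    (htT : t ≤ T) (hc : 0 < c) (hμ : 0 < μ)
    (hy : ContinuousOn y (Icc t T)) (hz : ContinuousOn z (Icc t T))
    (hD : ∀ s ∈ Ioo t T, HasDerivAt (fun s => ⟪y s, z s⟫_ℝ) (D' s) s)
    (hD' : ∀ s ∈ Ioo t T, D' s ≤ -c * (‖y s‖ ^ 2 + ‖z s‖ ^ 2))
    (hT : μ * ‖y T‖ ^ 2 ≤ ⟪y T, z T⟫_ℝ) (hzT : ‖z T‖ ≤ κ * ‖y T‖) (h0 : y t = 0) :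
    ∀ s ∈ Icc t T, y s = 0 ∧ z s = 0 := by
  have hDc : ContinuousOn (fun s => ⟪y s, z s⟫_ℝ) (Icc t T) := by fun_prop
  have hanti : AntitoneOn (fun s => ⟪y s, z s⟫_ℝ) (Icc t T) := by
    refine antitoneOn_of_deriv_nonpos (convex_Icc t T) hDc ?_ ?_
    · rw [interior_Icc]
      exact fun s hs => (hD s hs).differentiableAt.differentiableWithinAt
    · rw [interior_Icc]
      intro s hs
      rw [(hD s hs).deriv]
      have := hD' s hs
      have : 0 ≤ c * (‖y s‖ ^ 2 + ‖z s‖ ^ 2) := by positivity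
      linarith
  have hyT : 0 ≤ μ * ‖y T‖ ^ 2 := by positivity
  have hzero : ∀ s ∈ Icc t T, ⟪y s, z s⟫_ℝ = 0 := by
    intro s hs
    have h1 := hanti (left_mem_Icc.2 htT) hs hs.1
    have h2 := hanti hs (right_mem_Icc.2 htT) hs.2
    simp only [h0, inner_zero_left] at h1
    simp only at h2
    linarith
  have hin : ∀ s ∈ Ioo t T, y s = 0 ∧ z s = 0 := by
    intro s hs
    have h1 : HasDerivAt (fun s => ⟪y s, z s⟫_ℝ) 0 s :=
      (hasDerivAt_const s (0 : ℝ)).congr_of_eventuallyEq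
        (by filter_upwards [Ioo_mem_nhds hs.1 hs.2] with r hr
            exact hzero r (Ioo_subset_Icc_self hr))
    have h2 := hD' s hs
    rw [(hD s hs).unique h1] at h2
    have h3 : ‖y s‖ ^ 2 + ‖z s‖ ^ 2 ≤ 0 := by nlinarith
    exact ⟨norm_eq_zero.1 (by nlinarith [sq_nonneg ‖y s‖, sq_nonneg ‖z s‖]),
      norm_eq_zero.1 (by nlinarith [sq_nonneg ‖y s‖, sq_nonneg ‖z s‖])⟩
  rcases htT.eq_or_lt with rfl | hlt
  · intro s hs
    obtain rfl : s = t := le_antisymm hs.2 hs.1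
    exact ⟨h0, norm_le_zero_iff.1 (by simpa [h0] using hzT)⟩
  · have hcl : Icc t T ⊆ closure (Ioo t T) := by rw [closure_Ioo hlt.ne]
    have hy0 : EqOn y (fun _ => 0) (Icc t T) :=
      EqOn.of_subset_closure (fun s hs => (hin s hs).1) hy continuousOn_const
        Ioo_subset_Icc_self hcl
    have hz0 : EqOn z (fun _ => 0) (Icc t T) :=
      EqOn.of_subset_closure (fun s hs => (hin s hs).2) hz continuousOn_const
        Ioo_subset_Icc_self hcl
    exact fun s hs => ⟨hy0 hs, hz0 hs⟩

end Energy

/-! ### A priori estimates for the forward-backward system -/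

section FB

variable {H V : Type*}
  [NormedAddCommGroup H] [InnerProductSpace ℝ H] [CompleteSpace H]
  [NormedAddCommGroup V] [InnerProductSpace ℝ V] [CompleteSpace V]

/-- The right-hand side of the backward equation, solved for `dz/ds`. -/
noncomputable def costateField (A : H → H) (F : H → ℝ) (y z : H) : H :=
  -(ContinuousLinearMap.adjoint (fderiv ℝ A y) z + gradient F y)

/-- The assumptions on the data of the control problem that the analysis of the forward-backward
system uses. The signs of `b`, `M` and `MT` are part of them: in a nonzero state space they follow
from the other bounds. -/
structure Hypotheses (A : H → H) (F FT : H → ℝ) (B : V →L[ℝ] H) (N : V ≃L[ℝ] V)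
    (γ b ν M νT MT m k T : ℝ) : Prop where
  A_zero : A 0 = 0
  contDiff_A : ContDiff ℝ 1 A
  norm_fderiv_A_le : ∀ x, ‖fderiv ℝ A x‖ ≤ γ
  norm_fderiv_A_sub_le : ∀ x₁ x₂,
    ‖fderiv ℝ A x₁ - fderiv ℝ A x₂‖ ≤ b * ‖x₁ - x₂‖ / (1 + max ‖x₁‖ ‖x₂‖)
  b_nonneg : 0 ≤ b
  contDiff_F : ContDiff ℝ 2 F
  gradient_F_zero : gradient F 0 = 0
  hessian_F : ∀ x ξ, ν * ‖ξ‖ ^ 2 ≤ fderiv ℝ (fderiv ℝ F) x ξ ξ ∧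
    fderiv ℝ (fderiv ℝ F) x ξ ξ ≤ M * ‖ξ‖ ^ 2
  ν_pos : 0 < ν
  M_nonneg : 0 ≤ M
  contDiff_FT : ContDiff ℝ 2 FT
  gradient_FT_zero : gradient FT 0 = 0
  hessian_FT : ∀ x ξ, νT * ‖ξ‖ ^ 2 ≤ fderiv ℝ (fderiv ℝ FT) x ξ ξ ∧
    fderiv ℝ (fderiv ℝ FT) x ξ ξ ≤ MT * ‖ξ‖ ^ 2
  νT_pos : 0 < νT
  MT_pos : 0 < MT
  m_pos : 0 < m
  coercive_gain : ∀ ξ : H, m * ‖ξ‖ ^ 2 ≤ ⟪gain B N ξ, ξ⟫_ℝ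
  k_pos : 0 < k
  k_lt_m : k < m
  sq_b_lt : b ^ 2 / 16 < (m - k) * (ν - k)
  alpha_lt : 0 < ν - b * alpha γ M νT MT k T 0

theorem alpha_anti {p q μ κ c T t : ℝ} (hc : 0 < c) (ht : 0 ≤ t) :
    alpha p q μ κ c T t ≤ alpha p q μ κ c T 0 := by
  unfold alpha
  have : 0 ≤ (p ^ 2 + q ^ 2) / c := by positivity
  nlinarith

theorem alpha_nonneg {p q μ κ c T : ℝ} (hc : 0 < c) (hμ : 0 < μ) (hT : 0 ≤ T) :
    0 ≤ alpha p q μ κ c T 0 := by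
  unfold alpha
  rw [sub_zero]
  positivity

namespace Hypotheses

variable {A : H → H} {F FT : H → ℝ} {B : V →L[ℝ] H} {N : V ≃L[ℝ] V}
  {γ b ν M νT MT m k T : ℝ}

theorem norm_A_sub_le (P : Hypotheses A F FT B N γ b ν M νT MT m k T) (x y : H) :
    ‖A x - A y‖ ≤ γ * ‖x - y‖ :=
  convex_univ.norm_image_sub_le_of_norm_fderiv_le (𝕜 := ℝ)
    (fun x _ => P.contDiff_A.differentiable one_ne_zero x) (fun x _ => P.norm_fderiv_A_le x)
    (mem_univ y) (mem_univ x)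

theorem γ_nonneg (P : Hypotheses A F FT B N γ b ν M νT MT m k T) : 0 ≤ γ :=
  (norm_nonneg _).trans (P.norm_fderiv_A_le 0)

theorem continuous_A (P : Hypotheses A F FT B N γ b ν M νT MT m k T) : Continuous A :=
  P.contDiff_A.continuous

theorem norm_gradient_F_sub_le (P : Hypotheses A F FT B N γ b ν M νT MT m k T) (x y : H) :
    ‖gradient F x - gradient F y‖ ≤ M * ‖x - y‖ :=
  norm_gradient_sub_le P.contDiff_F P.M_nonneg
    (fun x ξ => ⟨(mul_nonneg P.ν_pos.le (sq_nonneg _)).trans (P.hessian_F x ξ).1,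
      (P.hessian_F x ξ).2⟩) x y

theorem norm_gradient_FT_sub_le (P : Hypotheses A F FT B N γ b ν M νT MT m k T) (x y : H) :
    ‖gradient FT x - gradient FT y‖ ≤ MT * ‖x - y‖ :=
  norm_gradient_sub_le P.contDiff_FT P.MT_pos.le
    (fun x ξ => ⟨(mul_nonneg P.νT_pos.le (sq_nonneg _)).trans (P.hessian_FT x ξ).1,
      (P.hessian_FT x ξ).2⟩) x y

theorem norm_adjoint_fderiv_le (P : Hypotheses A F FT B N γ b ν M νT MT m k T) (y z : H) :
    ‖ContinuousLinearMap.adjoint (fderiv ℝ A y) z‖ ≤ γ * ‖z‖ := by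
  refine (ContinuousLinearMap.le_opNorm _ _).trans ?_
  rw [LinearIsometryEquiv.norm_map]
  exact mul_le_mul_of_nonneg_right (P.norm_fderiv_A_le y) (norm_nonneg _)

theorem norm_costateField_le (P : Hypotheses A F FT B N γ b ν M νT MT m k T) (y z : H) :
    ‖costateField A F y z‖ ≤ γ * ‖z‖ + M * ‖y‖ := by
  rw [costateField, norm_neg]
  refine (norm_add_le _ _).trans (add_le_add (P.norm_adjoint_fderiv_le y z) ?_)
  simpa [P.gradient_F_zero] using P.norm_gradient_F_sub_le y 0

/-- The weight `1 / (1 + max |y₁| |y₂|)` in the bound for `DA(y₁) - DA(y₂)` absorbs the growth of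
the costate: it suffices that `|z₂| ≤ a (1 + |y₂|)`. -/
theorem norm_costateField_sub_le (P : Hypotheses A F FT B N γ b ν M νT MT m k T) {a : ℝ}
    {y₁ y₂ z₁ z₂ : H} (hz : ‖z₂‖ ≤ a * (1 + ‖y₂‖)) :
    ‖costateField A F y₁ z₁ - costateField A F y₂ z₂‖
      ≤ γ * ‖z₁ - z₂‖ + (M + b * a) * ‖y₁ - y₂‖ := by
  have e : costateField A F y₁ z₁ - costateField A F y₂ z₂
      = -(ContinuousLinearMap.adjoint (fderiv ℝ A y₁) (z₁ - z₂)
        + ContinuousLinearMap.adjoint (fderiv ℝ A y₁ - fderiv ℝ A y₂) z₂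
        + (gradient F y₁ - gradient F y₂)) := by
    simp only [costateField, map_sub, sub_apply]
    abel
  rw [e, norm_neg]
  have h1 := P.norm_adjoint_fderiv_le y₁ (z₁ - z₂)
  have h2 : ‖ContinuousLinearMap.adjoint (fderiv ℝ A y₁ - fderiv ℝ A y₂) z₂‖
      ≤ b * a * ‖y₁ - y₂‖ := by
    refine (ContinuousLinearMap.le_opNorm _ _).trans ?_
    rw [LinearIsometryEquiv.norm_map]
    have hb := P.b_nonneg
    have hpos : 0 < 1 + max ‖y₁‖ ‖y₂‖ := by positivity
    have ha : 0 ≤ a := by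
      by_contra! hneg
      have : a * (1 + ‖y₂‖) < 0 := mul_neg_of_neg_of_pos hneg (by positivity)
      linarith [norm_nonneg z₂]
    calc ‖fderiv ℝ A y₁ - fderiv ℝ A y₂‖ * ‖z₂‖
        ≤ b * ‖y₁ - y₂‖ / (1 + max ‖y₁‖ ‖y₂‖) * (a * (1 + max ‖y₁‖ ‖y₂‖)) := by
          refine mul_le_mul (P.norm_fderiv_A_sub_le y₁ y₂) (hz.trans ?_) (norm_nonneg _)
            (by positivity)
          gcongr
          exact le_max_right _ _
      _ = _ := by field_simp
  have h3 := P.norm_gradient_F_sub_le y₁ y₂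
  calc _ ≤ γ * ‖z₁ - z₂‖ + b * a * ‖y₁ - y₂‖ + M * ‖y₁ - y₂‖ :=
        (norm_add₃_le).trans (add_le_add (add_le_add h1 h2) h3)
    _ = _ := by ring

/-- Along the forward-backward system `⟪y, z⟫` decreases at rate at least `k (|y|² + |z|²)`. -/
theorem dissipation (P : Hypotheses A F FT B N γ b ν M νT MT m k T) (y z : H) :
    ⟪y, costateField A F y z⟫_ℝ + ⟪A y - gain B N z, z⟫_ℝ ≤ -k * (‖y‖ ^ 2 + ‖z‖ ^ 2) := by
  have hb := P.b_nonneg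
  have e : ⟪y, costateField A F y z⟫_ℝ + ⟪A y - gain B N z, z⟫_ℝ
      = ⟪A y - fderiv ℝ A y y, z⟫_ℝ - ⟪gain B N z, z⟫_ℝ - ⟪gradient F y, y⟫_ℝ := by
    rw [costateField, inner_neg_right, inner_add_right, ContinuousLinearMap.adjoint_inner_right,
      inner_sub_left, inner_sub_left, real_inner_comm y (gradient F y)]
    ring
  rw [e]
  have h1 : ‖A y - fderiv ℝ A y y‖ ≤ b / 2 * ‖y‖ := by
    have h := norm_sub_sub_fderiv_le P.contDiff_A hb P.norm_fderiv_A_sub_le 0 y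
    rw [P.A_zero, zero_sub, zero_sub, map_neg, norm_neg, sub_neg_eq_add, ← norm_neg, neg_add,
      neg_neg, ← sub_eq_add_neg] at h
    refine h.trans ?_
    rw [div_le_iff₀ (by positivity)]
    nlinarith [norm_nonneg y, mul_nonneg hb (norm_nonneg y)]
  have h2 : ⟪A y - fderiv ℝ A y y, z⟫_ℝ ≤ b / 2 * ‖y‖ * ‖z‖ :=
    (real_inner_le_norm _ _).trans (mul_le_mul_of_nonneg_right h1 (norm_nonneg z))
  have h3 := P.coercive_gain z
  have h4 : ν * ‖y‖ ^ 2 ≤ ⟪gradient F y, y⟫_ℝ := by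
    simpa [P.gradient_F_zero] using
      le_inner_gradient_sub P.contDiff_F (fun x ξ => (P.hessian_F x ξ).1) y 0
  -- The quadratic form `(m - k) |z|² - (b / 2) |y| |z| + (ν - k) |y|²` is nonnegative.
  have h5 : b / 2 * ‖y‖ * ‖z‖ ≤ (m - k) * ‖z‖ ^ 2 + (ν - k) * ‖y‖ ^ 2 := by
    have hmk : 0 < m - k := sub_pos.2 P.k_lt_m
    refine le_of_mul_le_mul_left ?_ hmk
    have := mul_le_mul_of_nonneg_right P.sq_b_lt.le (sq_nonneg ‖y‖)
    nlinarith [sq_nonneg ((m - k) * ‖z‖ - b / 4 * ‖y‖)]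
  linarith

theorem inner_taylor_le (P : Hypotheses A F FT B N γ b ν M νT MT m k T) {a : ℝ} (ha : 0 ≤ a)
    {x y z : H} (hz : ‖z‖ ≤ a * ‖y‖) :
    |⟪A x - A y - fderiv ℝ A y (x - y), z⟫_ℝ| ≤ b * a / 2 * ‖x - y‖ ^ 2 := by
  have hb := P.b_nonneg
  have h1 := norm_sub_sub_fderiv_le P.contDiff_A hb P.norm_fderiv_A_sub_le x y
  calc _ ≤ ‖A x - A y - fderiv ℝ A y (x - y)‖ * ‖z‖ := abs_real_inner_le_norm _ _
    _ ≤ b / 2 * ‖x - y‖ ^ 2 / (1 + ‖y‖) * (a * (1 + ‖y‖)) := by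
      refine mul_le_mul h1 (hz.trans ?_) (norm_nonneg _) (by positivity)
      nlinarith
    _ = _ := by field_simp

/-- Differences of solutions dissipate as well, provided that the costates satisfy
`|z| ≤ a |y|`. -/
theorem dissipation_sub (P : Hypotheses A F FT B N γ b ν M νT MT m k T) {a : ℝ} (ha : 0 ≤ a)
    {y₁ y₂ z₁ z₂ : H} (hz₁ : ‖z₁‖ ≤ a * ‖y₁‖) (hz₂ : ‖z₂‖ ≤ a * ‖y₂‖) :
    ⟪y₁ - y₂, costateField A F y₁ z₁ - costateField A F y₂ z₂⟫_ℝ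
        + ⟪(A y₁ - gain B N z₁) - (A y₂ - gain B N z₂), z₁ - z₂⟫_ℝ
      ≤ -min m (ν - b * a) * (‖y₁ - y₂‖ ^ 2 + ‖z₁ - z₂‖ ^ 2) := by
  have e : ⟪y₁ - y₂, costateField A F y₁ z₁ - costateField A F y₂ z₂⟫_ℝ
        + ⟪(A y₁ - gain B N z₁) - (A y₂ - gain B N z₂), z₁ - z₂⟫_ℝ
      = -⟪A y₂ - A y₁ - fderiv ℝ A y₁ (y₂ - y₁), z₁⟫_ℝ
        - ⟪A y₁ - A y₂ - fderiv ℝ A y₂ (y₁ - y₂), z₂⟫_ℝ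
        - ⟪gain B N (z₁ - z₂), z₁ - z₂⟫_ℝ
        - ⟪gradient F y₁ - gradient F y₂, y₁ - y₂⟫_ℝ := by
    simp only [costateField, map_sub, inner_sub_left, inner_sub_right, inner_neg_right,
      inner_add_right, ContinuousLinearMap.adjoint_inner_right]
    rw [real_inner_comm y₁ (gradient F y₁), real_inner_comm y₁ (gradient F y₂),
      real_inner_comm y₂ (gradient F y₁), real_inner_comm y₂ (gradient F y₂)]
    ring
  rw [e]
  have h1 := (abs_le.1 (P.inner_taylor_le ha (x := y₂) hz₁)).1
  have h2 := (abs_le.1 (P.inner_taylor_le ha (x := y₁) hz₂)).1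
  rw [norm_sub_rev] at h1
  have h3 := P.coercive_gain (z₁ - z₂)
  have h4 := le_inner_gradient_sub P.contDiff_F (fun x ξ => (P.hessian_F x ξ).1) y₁ y₂
  have h5 := mul_le_mul_of_nonneg_right (min_le_left m (ν - b * a)) (sq_nonneg ‖z₁ - z₂‖)
  have h6 := mul_le_mul_of_nonneg_right (min_le_right m (ν - b * a)) (sq_nonneg ‖y₁ - y₂‖)
  linarith

end Hypotheses

namespace IsFBSolution

variable {A : H → H} {F FT : H → ℝ} {B : V →L[ℝ] H} {N : V ≃L[ℝ] V}
  {γ b ν M νT MT m k T t : ℝ} {x x₁ x₂ : H} {y z y₁ y₂ z₁ z₂ : ℝ → H}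

theorem restrict (S : IsFBSolution A B N F FT t T x y z) {s : ℝ} (hs : t ≤ s) :
    IsFBSolution A B N F FT s T (y s) y z where
  continuousOn_y := S.continuousOn_y.mono (Icc_subset_Icc_left hs)
  continuousOn_z := S.continuousOn_z.mono (Icc_subset_Icc_left hs)
  forward r hr := S.forward r ⟨hs.trans_lt hr.1, hr.2⟩
  backward r hr := S.backward r ⟨hs.trans_lt hr.1, hr.2⟩
  initial := rfl
  terminal := S.terminal

theorem continuousOn_costateField (P : Hypotheses A F FT B N γ b ν M νT MT m k T)
    (S : IsFBSolution A B N F FT t T x y z) :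
    ContinuousOn (fun s => costateField A F (y s) (z s)) (Icc t T) := by
  have h1 : Continuous fun w : H => ContinuousLinearMap.adjoint (fderiv ℝ A w) :=
    ContinuousLinearMap.adjoint.continuous.comp (P.contDiff_A.continuous_fderiv one_ne_zero)
  have h2 : ContinuousOn (fun s => ContinuousLinearMap.adjoint (fderiv ℝ A (y s))) (Icc t T) :=
    h1.comp_continuousOn S.continuousOn_y
  have h3 : ContinuousOn (fun s => gradient F (y s)) (Icc t T) :=
    (continuous_gradient P.contDiff_F).comp_continuousOn S.continuousOn_y
  exact ((h2.clm_apply S.continuousOn_z).add h3).neg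

theorem norm_costate_le (P : Hypotheses A F FT B N γ b ν M νT MT m k T)
    (S : IsFBSolution A B N F FT t T x y z) (ht : 0 ≤ t) {s : ℝ} (hs : s ∈ Icc t T) :
    ‖z s‖ ≤ alpha γ M νT MT k T 0 * ‖y s‖ := by
  have S' := S.restrict hs.1
  refine (norm_le_alpha_mul_norm hs.2 P.k_pos P.νT_pos P.MT_pos S'.continuousOn_y
    S'.continuousOn_z S'.backward (fun r hr => (S'.forward r hr).inner ℝ (S'.backward r hr))
    (fun r _ => P.norm_costateField_le (y r) (z r)) (fun r _ => P.dissipation (y r) (z r))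
    ?_ ?_).trans (mul_le_mul_of_nonneg_right (alpha_anti P.k_pos (ht.trans hs.1)) (norm_nonneg _))
  · rw [S.terminal, real_inner_comm]
    simpa [P.gradient_FT_zero] using
      le_inner_gradient_sub P.contDiff_FT (fun x ξ => (P.hessian_FT x ξ).1) (y T) 0
  · rw [S.terminal]
    simpa [P.gradient_FT_zero] using P.norm_gradient_FT_sub_le (y T) 0

/-- The costate of a solution depends on the state in a Lipschitz way, with the constant
`alpha γ (M + b a) νT MT c T 0`, where `a = alpha γ M νT MT k T 0` and `c = min m (ν - b a)`. -/
theorem norm_costate_sub_le (P : Hypotheses A F FT B N γ b ν M νT MT m k T)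
    (S₁ : IsFBSolution A B N F FT t T x₁ y₁ z₁) (S₂ : IsFBSolution A B N F FT t T x₂ y₂ z₂)
    (ht : 0 ≤ t) {s : ℝ} (hs : s ∈ Icc t T) :
    ‖z₁ s - z₂ s‖ ≤ alpha γ (M + b * alpha γ M νT MT k T 0) νT MT
      (min m (ν - b * alpha γ M νT MT k T 0)) T 0 * ‖y₁ s - y₂ s‖ := by
  set a := alpha γ M νT MT k T 0
  have ha : 0 ≤ a := alpha_nonneg P.k_pos P.νT_pos (ht.trans (hs.1.trans hs.2))
  have hc : 0 < min m (ν - b * a) := lt_min P.m_pos P.alpha_lt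
  have S₁' := S₁.restrict hs.1
  have S₂' := S₂.restrict hs.1
  have hz₁ (r) (hr : r ∈ Ioo s T) : ‖z₁ r‖ ≤ a * ‖y₁ r‖ :=
    S₁'.norm_costate_le P (ht.trans hs.1) (Ioo_subset_Icc_self hr)
  have hz₂ (r) (hr : r ∈ Ioo s T) : ‖z₂ r‖ ≤ a * ‖y₂ r‖ :=
    S₂'.norm_costate_le P (ht.trans hs.1) (Ioo_subset_Icc_self hr)
  refine (norm_le_alpha_mul_norm (y := fun r => y₁ r - y₂ r) (z := fun r => z₁ r - z₂ r)
    (h := fun r => costateField A F (y₁ r) (z₁ r) - costateField A F (y₂ r) (z₂ r))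
    (p := γ) (q := M + b * a) hs.2 hc P.νT_pos P.MT_pos
    (S₁'.continuousOn_y.sub S₂'.continuousOn_y) (S₁'.continuousOn_z.sub S₂'.continuousOn_z)
    (fun r hr => (S₁'.backward r hr).sub (S₂'.backward r hr))
    (fun r hr => ((S₁'.forward r hr).sub (S₂'.forward r hr)).inner ℝ
      ((S₁'.backward r hr).sub (S₂'.backward r hr)))
    (fun r hr => P.norm_costateField_sub_le ((hz₂ r hr).trans ?_))
    (fun r hr => P.dissipation_sub ha (hz₁ r hr) (hz₂ r hr)) ?_ ?_).trans
    (mul_le_mul_of_nonneg_right (alpha_anti hc (ht.trans hs.1)) (norm_nonneg _))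
  · nlinarith
  · rw [S₁.terminal, S₂.terminal, real_inner_comm]
    exact le_inner_gradient_sub P.contDiff_FT (fun x ξ => (P.hessian_FT x ξ).1) (y₁ T) (y₂ T)
  · rw [S₁.terminal, S₂.terminal]
    exact P.norm_gradient_FT_sub_le (y₁ T) (y₂ T)

theorem unique (P : Hypotheses A F FT B N γ b ν M νT MT m k T)
    (S₁ : IsFBSolution A B N F FT t T x y₁ z₁) (S₂ : IsFBSolution A B N F FT t T x y₂ z₂)
    (ht : 0 ≤ t) (htT : t ≤ T) : EqOn y₁ y₂ (Icc t T) ∧ EqOn z₁ z₂ (Icc t T) := by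
  set a := alpha γ M νT MT k T 0
  have ha : 0 ≤ a := alpha_nonneg P.k_pos P.νT_pos (ht.trans htT)
  have hc : 0 < min m (ν - b * a) := lt_min P.m_pos P.alpha_lt
  have key := eq_zero_of_dissipative (y := fun r => y₁ r - y₂ r) (z := fun r => z₁ r - z₂ r)
    htT hc P.νT_pos
    (S₁.continuousOn_y.sub S₂.continuousOn_y) (S₁.continuousOn_z.sub S₂.continuousOn_z)
    (fun r hr => ((S₁.forward r hr).sub (S₂.forward r hr)).inner ℝ
      ((S₁.backward r hr).sub (S₂.backward r hr)))
    (fun r hr => P.dissipation_sub ha (S₁.norm_costate_le P ht (Ioo_subset_Icc_self hr))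
      (S₂.norm_costate_le P ht (Ioo_subset_Icc_self hr)))
    (by
      rw [S₁.terminal, S₂.terminal, real_inner_comm]
      exact le_inner_gradient_sub P.contDiff_FT (fun x ξ => (P.hessian_FT x ξ).1) (y₁ T) (y₂ T))
    (by
      rw [S₁.terminal, S₂.terminal]
      exact P.norm_gradient_FT_sub_le (y₁ T) (y₂ T))
    (by rw [S₁.initial, S₂.initial, sub_self])
  exact ⟨fun s hs => sub_eq_zero.1 (key s hs).1, fun s hs => sub_eq_zero.1 (key s hs).2⟩

theorem intervalIntegrable_forward (P : Hypotheses A F FT B N γ b ν M νT MT m k T)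
    (S : IsFBSolution A B N F FT t T x y z) {r s : ℝ} (hr : t ≤ r) (hrs : r ≤ s) (hs : s ≤ T) :
    IntervalIntegrable (fun τ => A (y τ) - gain B N (z τ)) volume r s := by
  refine ContinuousOn.intervalIntegrable ?_
  rw [uIcc_of_le hrs]
  have hsub : Icc r s ⊆ Icc t T := Icc_subset_Icc hr hs
  exact (P.continuous_A.comp_continuousOn (S.continuousOn_y.mono hsub)).sub
    ((gain B N).continuous.comp_continuousOn (S.continuousOn_z.mono hsub))

theorem integral_forward (P : Hypotheses A F FT B N γ b ν M νT MT m k T)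
    (S : IsFBSolution A B N F FT t T x y z) {r s : ℝ} (hr : t ≤ r) (hrs : r ≤ s) (hs : s ≤ T) :
    ∫ τ in r..s, (A (y τ) - gain B N (z τ)) = y s - y r :=
  intervalIntegral.integral_eq_sub_of_hasDerivAt_of_le hrs
    (S.continuousOn_y.mono (Icc_subset_Icc hr hs))
    (fun τ hτ => S.forward τ ⟨hr.trans_lt hτ.1, hτ.2.trans_le hs⟩)
    (S.intervalIntegrable_forward P hr hrs hs)

end IsFBSolution

end FB

/-! ### Global solutions of ordinary differential equations of linear growth -/

section ODE

open scoped NNReal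

variable {E : Type*} [NormedAddCommGroup E] [NormedSpace ℝ E]

/-- The radial retraction `x ↦ R x / max(R, |x|)` onto a ball. -/
noncomputable def radialRetraction (R : ℝ) (x : E) : E := (R / max R ‖x‖) • x

theorem radialRetraction_of_norm_le {R : ℝ} (hR : 0 < R) {x : E} (hx : ‖x‖ ≤ R) :
    radialRetraction R x = x := by
  rw [radialRetraction, max_eq_left hx, div_self hR.ne', one_smul]

theorem norm_radialRetraction_le {R : ℝ} (hR : 0 < R) (x : E) :
    ‖radialRetraction R x‖ ≤ min R ‖x‖ := by
  have h0 : 0 < max R ‖x‖ := lt_max_of_lt_left hR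
  rw [radialRetraction, norm_smul, Real.norm_of_nonneg (by positivity), div_mul_eq_mul_div,
    div_le_iff₀ h0]
  rcases le_total R ‖x‖ with h | h
  · rw [max_eq_right h, min_eq_left h]
  · rw [max_eq_left h, min_eq_right h, mul_comm]

theorem lipschitzWith_radialRetraction {R : ℝ} (hR : 0 < R) :
    LipschitzWith 2 (radialRetraction R : E → E) := by
  refine LipschitzWith.of_dist_le_mul fun x y => ?_
  rw [dist_eq_norm, dist_eq_norm]
  have hx : 0 < max R ‖x‖ := lt_max_of_lt_left hR
  have hy : 0 < max R ‖y‖ := lt_max_of_lt_left hR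
  have e : radialRetraction R x - radialRetraction R y
      = (R / max R ‖x‖) • (x - y) + (R / max R ‖x‖ - R / max R ‖y‖) • y := by
    simp only [radialRetraction, smul_sub, sub_smul]
    abel
  have h1 : ‖(R / max R ‖x‖) • (x - y)‖ ≤ ‖x - y‖ := by
    rw [norm_smul, Real.norm_of_nonneg (by positivity)]
    exact mul_le_of_le_one_left (norm_nonneg _) ((div_le_one hx).2 (le_max_left _ _))
  have h2 : ‖(R / max R ‖x‖ - R / max R ‖y‖) • y‖ ≤ ‖x - y‖ := by
    have e2 : R / max R ‖x‖ - R / max R ‖y‖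
        = (max R ‖y‖ - max R ‖x‖) * (R / max R ‖x‖) / max R ‖y‖ := by field_simp
    have h3 : |max R ‖y‖ - max R ‖x‖| ≤ ‖x - y‖ := by
      have h4 := abs_max_sub_max_le_abs ‖y‖ ‖x‖ R
      rw [max_comm ‖y‖ R, max_comm ‖x‖ R] at h4
      exact h4.trans ((abs_norm_sub_norm_le y x).trans_eq (norm_sub_rev y x))
    rw [norm_smul, e2, Real.norm_eq_abs, abs_div, abs_mul, abs_of_pos hy,
      abs_of_nonneg (by positivity : (0 : ℝ) ≤ R / max R ‖x‖), div_mul_eq_mul_div, div_le_iff₀ hy]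
    exact mul_le_mul
      ((mul_le_of_le_one_right (abs_nonneg _) ((div_le_one hx).2 (le_max_left _ _))).trans h3)
      (le_max_right _ _) (norm_nonneg _) (norm_nonneg _)
  rw [e]
  refine (norm_add_le _ _).trans ((add_le_add h1 h2).trans_eq ?_)
  push_cast
  ring

theorem exists_hasDerivAt_of_lipschitzWith [CompleteSpace E] {f : E → E} {K : ℝ≥0}
    (hf : LipschitzWith K f) {T : ℝ} (hT : 0 ≤ T) (x₀ : E) :
    ∃ ξ : ℝ → E, ξ 0 = x₀ ∧ ∀ s ∈ Icc 0 T, HasDerivAt ξ (f (ξ s)) s := by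
  obtain ⟨ξ, ⟨hc, h⟩, -⟩ := exists_unique_volterra hT hf (g := fun _ => x₀) continuousOn_const
  -- The right-hand side of the integral equation, unlike `ξ`, is differentiable at the endpoints.
  refine ⟨fun s => x₀ + ∫ τ in 0..s, f (ξ τ), by simp, fun s hs => ?_⟩
  simp only
  rw [← h s hs]
  have hfc : Continuous fun τ => f (ξ τ) := hf.continuous.comp hc
  exact (intervalIntegral.integral_hasDerivAt_right (hfc.intervalIntegrable _ _)
    (hfc.stronglyMeasurableAtFilter _ _) hfc.continuousAt).const_add x₀

/-- A vector field of linear growth that is Lipschitz on balls has global solutions: the growth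
bound confines a solution of the truncated equation to the ball where nothing is truncated. -/
theorem exists_hasDerivAt_of_linear_growth [CompleteSpace E] {f : E → E} {C : ℝ} (hC : 0 ≤ C)
    (hgrowth : ∀ x, ‖f x‖ ≤ C * ‖x‖)
    (hlip : ∀ R : ℝ, 0 < R → ∃ K : ℝ≥0, LipschitzOnWith K f (Metric.closedBall 0 R))
    {T : ℝ} (hT : 0 ≤ T) (x₀ : E) :
    ∃ ξ : ℝ → E, ξ 0 = x₀ ∧ ∀ s ∈ Icc 0 T, HasDerivAt ξ (f (ξ s)) s := by
  set R := ‖x₀‖ * Real.exp (C * T) + 1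
  have hR : 0 < R := by positivity
  obtain ⟨K, hK⟩ := hlip R hR
  have hball (x : E) : radialRetraction R x ∈ Metric.closedBall (0 : E) R := by
    rw [mem_closedBall_zero_iff]
    exact (norm_radialRetraction_le hR x).trans (min_le_left _ _)
  have hLip : LipschitzWith (K * 2) fun x => f (radialRetraction R x) :=
    lipschitzOnWith_univ.1 (hK.comp (lipschitzWith_radialRetraction hR).lipschitzOnWith
      fun x _ => hball x)
  obtain ⟨ξ, h0, hξ⟩ := exists_hasDerivAt_of_lipschitzWith hLip hT x₀
  refine ⟨ξ, h0, fun s hs => ?_⟩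
  have hbound := norm_le_gronwallBound_of_norm_deriv_right_le (f := ξ) (δ := ‖x₀‖) (K := C)
    (ε := 0) (a := 0) (b := T)
    (fun r hr => (hξ r hr).continuousAt.continuousWithinAt)
    (fun r hr => (hξ r (Ico_subset_Icc_self hr)).hasDerivWithinAt) (by rw [h0])
    (fun r _ => by
      rw [add_zero]
      exact (hgrowth _).trans (mul_le_mul_of_nonneg_left
        ((norm_radialRetraction_le hR _).trans (min_le_right _ _)) hC)) s hs
  rw [gronwallBound_ε0, sub_zero] at hbound
  have hle : ‖ξ s‖ ≤ R := by
    refine hbound.trans ?_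
    have : Real.exp (C * s) ≤ Real.exp (C * T) :=
      Real.exp_le_exp.2 (mul_le_mul_of_nonneg_left hs.2 hC)
    have := mul_le_mul_of_nonneg_left this (norm_nonneg x₀)
    exact this.trans (le_add_of_nonneg_right zero_le_one)
  have := hξ s hs
  rwa [radialRetraction_of_norm_le hR hle] at this

end ODE

/-! ### Existence for the forward-backward system by shooting -/

section Shooting

open scoped NNReal

variable {H V : Type*}
  [NormedAddCommGroup H] [InnerProductSpace ℝ H] [CompleteSpace H]
  [NormedAddCommGroup V] [InnerProductSpace ℝ V] [CompleteSpace V]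
  {A : H → H} {F FT : H → ℝ} {B : V →L[ℝ] H} {N : V ≃L[ℝ] V}
  {γ b ν M νT MT m k T : ℝ}

/-- Every terminal state is reached by a solution of the system on `[0, T]`: the terminal
condition turns the system into a Cauchy problem backward in time. -/
theorem exists_isFBSolution_terminal (P : Hypotheses A F FT B N γ b ν M νT MT m k T)
    (hT : 0 ≤ T) (p : H) :
    ∃ y z : ℝ → H, IsFBSolution A B N F FT 0 T (y 0) y z ∧ y T = p := by
  have hγ := P.γ_nonneg
  have hM := P.M_nonneg
  have hb := P.b_nonneg
  let f : H × H → H × H := fun w => (-(A w.1 - gain B N w.2), -costateField A F w.1 w.2)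
  have hgrowth (w : H × H) : ‖f w‖ ≤ (γ + ‖gain B N‖ + M) * ‖w‖ := by
    have h1 := norm_fst_le w
    have h2 := norm_snd_le w
    have hG := norm_nonneg (gain B N)
    have h3 : ‖A w.1‖ ≤ γ * ‖w.1‖ := by simpa [P.A_zero] using P.norm_A_sub_le w.1 0
    have h4 := (gain B N).le_opNorm w.2
    rw [Prod.norm_def]
    simp only [f, norm_neg]
    refine max_le ((norm_sub_le _ _).trans ?_) ((P.norm_costateField_le _ _).trans ?_)
    · nlinarith [norm_nonneg w]
    · nlinarith [norm_nonneg w]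
  have hlip (R : ℝ) (hR : 0 < R) : ∃ K : ℝ≥0, LipschitzOnWith K f (Metric.closedBall 0 R) := by
    refine ⟨Real.toNNReal (γ + ‖gain B N‖ + (M + b * R)), LipschitzOnWith.of_dist_le_mul ?_⟩
    intro w₁ _ w₂ hw₂
    have hG := norm_nonneg (gain B N)
    rw [Real.coe_toNNReal _ (by positivity), dist_eq_norm, dist_eq_norm]
    have h1 := norm_fst_le (w₁ - w₂)
    have h2 := norm_snd_le (w₁ - w₂)
    rw [Prod.fst_sub] at h1
    rw [Prod.snd_sub] at h2
    have h0 := norm_nonneg (w₁ - w₂)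
    rw [Prod.norm_def (f w₁ - f w₂)]
    refine max_le ?_ ?_
    · have e : (f w₁ - f w₂).1 = gain B N (w₁.2 - w₂.2) - (A w₁.1 - A w₂.1) := by
        simp only [f, Prod.fst_sub, map_sub]
        abel
      rw [e]
      have h3 := P.norm_A_sub_le w₁.1 w₂.1
      have h4 := (gain B N).le_opNorm (w₁.2 - w₂.2)
      refine (norm_sub_le _ _).trans ?_
      nlinarith [mul_nonneg hb hR.le]
    · have e : (f w₁ - f w₂).2 = -(costateField A F w₁.1 w₁.2 - costateField A F w₂.1 w₂.2) := by
        simp only [f, Prod.snd_sub]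
        abel
      rw [e, norm_neg]
      have hz : ‖w₂.2‖ ≤ R * (1 + ‖w₂.1‖) := by
        have h5 : ‖w₂.2‖ ≤ R := (norm_snd_le w₂).trans (mem_closedBall_zero_iff.1 hw₂)
        nlinarith [norm_nonneg w₂.1]
      refine (P.norm_costateField_sub_le hz).trans ?_
      nlinarith [mul_nonneg hb hR.le]
  obtain ⟨ξ, hξ0, hξ⟩ := exists_hasDerivAt_of_linear_growth (by positivity) hgrowth hlip hT
    (p, gradient FT p)
  have hd (s : ℝ) (hs : s ∈ Icc 0 T) : HasDerivAt (fun s => ξ (T - s)) (-f (ξ (T - s))) s := by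
    have := (hξ (T - s) ⟨sub_nonneg.2 hs.2, sub_le_self T hs.1⟩).scomp s
      ((hasDerivAt_id s).const_sub T)
    exact this.congr_deriv (by simp)
  have hd1 (s : ℝ) (hs : s ∈ Icc 0 T) :
      HasDerivAt (fun s => (ξ (T - s)).1) (A (ξ (T - s)).1 - gain B N (ξ (T - s)).2) s := by
    have := (hasFDerivAt_fst (𝕜 := ℝ) (p := ξ (T - s))).comp_hasDerivAt s (hd s hs)
    exact this.congr_deriv (by simp [f])
  have hd2 (s : ℝ) (hs : s ∈ Icc 0 T) :
      HasDerivAt (fun s => (ξ (T - s)).2) (costateField A F (ξ (T - s)).1 (ξ (T - s)).2) s := by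
    have := (hasFDerivAt_snd (𝕜 := ℝ) (p := ξ (T - s))).comp_hasDerivAt s (hd s hs)
    exact this.congr_deriv (by simp [f])
  refine ⟨fun s => (ξ (T - s)).1, fun s => (ξ (T - s)).2, ⟨?_, ?_, ?_, ?_, rfl, ?_⟩, ?_⟩
  · exact fun s hs => (hd1 s hs).continuousAt.continuousWithinAt
  · exact fun s hs => (hd2 s hs).continuousAt.continuousWithinAt
  · exact fun s hs => hd1 s (Ioo_subset_Icc_self hs)
  · exact fun s hs => hd2 s (Ioo_subset_Icc_self hs)
  · simp [hξ0]
  · simp [hξ0]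

/-- If the costates of two solutions differ by at most `L` times the difference of the states, then
over a short time interval the difference of the states changes by at most half its final
value. -/
theorem IsFBSolution.norm_increment_sub_le (P : Hypotheses A F FT B N γ b ν M νT MT m k T)
    {t : ℝ} {x₁ x₂ : H} {y₁ z₁ y₂ z₂ : ℝ → H}
    (S₁ : IsFBSolution A B N F FT t T x₁ y₁ z₁) (S₂ : IsFBSolution A B N F FT t T x₂ y₂ z₂)
    {L : ℝ} (hL : 0 ≤ L) (hz : ∀ s ∈ Icc t T, ‖z₁ s - z₂ s‖ ≤ L * ‖y₁ s - y₂ s‖)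
    {r s : ℝ} (hr : t ≤ r) (hrs : r ≤ s) (hs : s ≤ T)
    (hshort : (γ + ‖gain B N‖ * L) * (s - r) ≤ 1 / 3) :
    ‖(y₁ r - y₁ s) - (y₂ r - y₂ s)‖ ≤ 1 / 2 * ‖y₁ s - y₂ s‖ := by
  have hγ := P.γ_nonneg
  have hsub : Icc r s ⊆ Icc t T := Icc_subset_Icc hr hs
  obtain ⟨σ, hσ, hmax⟩ := isCompact_Icc.exists_isMaxOn (nonempty_Icc.2 hrs)
    ((S₁.continuousOn_y.sub S₂.continuousOn_y).mono hsub).norm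
  -- On a short interval the largest difference `μ` is controlled by the final one, since the
  -- difference varies by at most `μ / 3`.
  set μ := ‖y₁ σ - y₂ σ‖
  have hle (τ : ℝ) (hτ : τ ∈ Icc r s) : ‖y₁ τ - y₂ τ‖ ≤ μ := hmax hτ
  have hμ : 0 ≤ μ := norm_nonneg _
  have hincr (ρ : ℝ) (hρ : ρ ∈ Icc r s) : ‖(y₁ ρ - y₁ s) - (y₂ ρ - y₂ s)‖ ≤ 1 / 3 * μ := by
    have e : (y₁ ρ - y₁ s) - (y₂ ρ - y₂ s) = -∫ τ in ρ..s,
        ((A (y₁ τ) - gain B N (z₁ τ)) - (A (y₂ τ) - gain B N (z₂ τ))) := by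
      rw [intervalIntegral.integral_sub
        (S₁.intervalIntegrable_forward P (hr.trans hρ.1) hρ.2 hs)
        (S₂.intervalIntegrable_forward P (hr.trans hρ.1) hρ.2 hs),
        S₁.integral_forward P (hr.trans hρ.1) hρ.2 hs,
        S₂.integral_forward P (hr.trans hρ.1) hρ.2 hs]
      abel
    rw [e, norm_neg]
    refine (intervalIntegral.norm_integral_le_of_norm_le_const
      (C := (γ + ‖gain B N‖ * L) * μ) fun τ hτ => ?_).trans ?_
    · rw [uIoc_of_le hρ.2] at hτ
      have hτ' : τ ∈ Icc r s := ⟨hρ.1.trans hτ.1.le, hτ.2⟩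
      have e2 : (A (y₁ τ) - gain B N (z₁ τ)) - (A (y₂ τ) - gain B N (z₂ τ))
          = (A (y₁ τ) - A (y₂ τ)) - gain B N (z₁ τ - z₂ τ) := by
        rw [map_sub]
        abel
      rw [e2]
      have h1 := P.norm_A_sub_le (y₁ τ) (y₂ τ)
      have h2 := (gain B N).le_opNorm (z₁ τ - z₂ τ)
      have h3 := hz τ (hsub hτ')
      calc _ ≤ γ * μ + ‖gain B N‖ * (L * μ) := by
            refine (norm_sub_le _ _).trans (add_le_add (h1.trans ?_) (h2.trans ?_))
            · exact mul_le_mul_of_nonneg_left (hle τ hτ') hγ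
            · exact mul_le_mul_of_nonneg_left
                (h3.trans (mul_le_mul_of_nonneg_left (hle τ hτ') hL)) (norm_nonneg _)
        _ = _ := by ring
    · rw [abs_of_nonneg (sub_nonneg.2 hρ.2)]
      have h4 : (γ + ‖gain B N‖ * L) * (s - ρ) ≤ 1 / 3 :=
        (mul_le_mul_of_nonneg_left (sub_le_sub_left hρ.1 s) (by positivity)).trans hshort
      calc _ = (γ + ‖gain B N‖ * L) * (s - ρ) * μ := by ring
        _ ≤ _ := mul_le_mul_of_nonneg_right h4 hμ
  have h5 : μ ≤ 1 / 3 * μ + ‖y₁ s - y₂ s‖ := by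
    have e : y₁ σ - y₂ σ = ((y₁ σ - y₁ s) - (y₂ σ - y₂ s)) + (y₁ s - y₂ s) := by abel
    calc μ = ‖((y₁ σ - y₁ s) - (y₂ σ - y₂ s)) + (y₁ s - y₂ s)‖ := by rw [← e]
      _ ≤ _ := (norm_add_le _ _).trans (add_le_add_left (hincr σ hσ) _)
  have h6 := hincr r (left_mem_Icc.2 hrs)
  linarith

theorem surjective_of_contracting_sub {E : Type*} [NormedAddCommGroup E] [CompleteSpace E]
    {Ψ : E → E} (h : ∀ x₁ x₂, ‖(Ψ x₁ - x₁) - (Ψ x₂ - x₂)‖ ≤ 1 / 2 * ‖x₁ - x₂‖) :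
    Function.Surjective Ψ := by
  intro x
  have hc : ContractingWith (1 / 2) fun x' => x - (Ψ x' - x') := by
    refine ⟨by norm_num, LipschitzWith.of_dist_le_mul fun x₁ x₂ => ?_⟩
    rw [dist_eq_norm, dist_eq_norm, sub_sub_sub_cancel_left, norm_sub_rev]
    simpa using h x₁ x₂
  refine ⟨ContractingWith.fixedPoint _ hc, ?_⟩
  have := hc.fixedPoint_isFixedPt
  rw [Function.IsFixedPt] at this
  set x' := ContractingWith.fixedPoint _ hc
  have h2 : x = x' + (Ψ x' - x') := eq_add_of_sub_eq this
  rw [h2]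
  abel

/-- At each time `s` the states of the solutions on `[0, T]` fill the whole space. This propagates
backward from `s = T` in steps of fixed length, since the state at an earlier time is a perturbation
of the identity by a contraction, as a function of the state at the later time. -/
theorem exists_isFBSolution_through (P : Hypotheses A F FT B N γ b ν M νT MT m k T)
    (hT : 0 ≤ T) {s : ℝ} (hs : s ∈ Icc 0 T) (x : H) :
    ∃ y z : ℝ → H, IsFBSolution A B N F FT 0 T (y 0) y z ∧ y s = x := by
  set a := alpha γ M νT MT k T 0 with ha
  set L := alpha γ (M + b * a) νT MT (min m (ν - b * a)) T 0 with hL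
  have hc : 0 < min m (ν - b * a) := lt_min P.m_pos P.alpha_lt
  have hL0 : 0 ≤ L := alpha_nonneg hc P.νT_pos hT
  have hγ := P.γ_nonneg
  set κ := γ + ‖gain B N‖ * L
  have hκ : 0 ≤ κ := by positivity
  set δ := 1 / (3 * (κ + 1)) with hδ
  have hδ0 : 0 < δ := by positivity
  have hκδ : κ * δ ≤ 1 / 3 := by
    rw [hδ, mul_one_div, div_le_div_iff₀ (by positivity) (by norm_num)]
    linarith
  have main (n : ℕ) : ∀ s ∈ Icc 0 T, T - s ≤ n * δ → ∀ x : H,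
      ∃ y z : ℝ → H, IsFBSolution A B N F FT 0 T (y 0) y z ∧ y s = x := by
    induction n with
    | zero =>
      intro s hs hn x
      obtain rfl : s = T := le_antisymm hs.2 (by simpa using hn)
      exact exists_isFBSolution_terminal P hT x
    | succ n ih =>
      intro s hs hn
      have hs1 : s ≤ min (s + δ) T := le_min (by linarith) hs.2
      have hs1T : min (s + δ) T ≤ T := min_le_right _ _
      choose y z hyz hx using ih (min (s + δ) T) ⟨hs.1.trans hs1, hs1T⟩ (by
        push_cast at hn
        rcases le_total (s + δ) T with h | h
        · rw [min_eq_left h]; linarith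
        · rw [min_eq_right h, sub_self]; positivity)
      have hsurj : Function.Surjective fun x => y x s := by
        refine surjective_of_contracting_sub fun x₁ x₂ => ?_
        have key := (hyz x₁).norm_increment_sub_le P (hyz x₂) hL0
          (fun r hr => (hyz x₁).norm_costate_sub_le P (hyz x₂) le_rfl hr) hs.1 hs1 hs1T
          ((mul_le_mul_of_nonneg_left (by linarith [min_le_left (s + δ) T]) hκ).trans hκδ)
        simpa only [hx] using key
      intro x
      obtain ⟨x', hx'⟩ := hsurj x
      exact ⟨y x', z x', hyz x', hx'⟩
  obtain ⟨n, hn⟩ := exists_nat_ge ((T - s) / δ)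
  exact main n s hs ((div_le_iff₀ hδ0).1 hn) x

end Shooting

/-! ### The state equation and the optimal control -/

section Integrability

variable {H V : Type*} [NormedAddCommGroup H] [InnerProductSpace ℝ H]
  [NormedAddCommGroup V] [InnerProductSpace ℝ V] {t T : ℝ}

theorem IsControl.intervalIntegrable {V : Type*} [NormedAddCommGroup V] {v : ℝ → V}
    (hv : IsControl t T v) (htT : t ≤ T) :
    IntervalIntegrable v volume t T :=
  (intervalIntegrable_iff_integrableOn_Ioc_of_le htT).2 (hv.integrable one_le_two)

theorem isControl_of_continuousOn {V : Type*} [NormedAddCommGroup V] {v : ℝ → V}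
    (hv : ContinuousOn v (Icc t T)) :
    IsControl t T v := by
  obtain ⟨C, hC⟩ := isCompact_Icc.exists_bound_of_continuousOn hv
  refine MemLp.of_bound ((hv.mono Ioc_subset_Icc_self).aestronglyMeasurable measurableSet_Ioc) C ?_
  filter_upwards [ae_restrict_mem measurableSet_Ioc] with s hs
  exact hC s (Ioc_subset_Icc_self hs)

theorem intervalIntegrable_clm_comp {v : ℝ → V} (B : V →L[ℝ] H)
    (hv : IntervalIntegrable v volume t T) : IntervalIntegrable (fun s => B (v s)) volume t T :=
  ⟨B.integrable_comp hv.1, B.integrable_comp hv.2⟩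

theorem intervalIntegrable_mono_Icc {E : Type*} [NormedAddCommGroup E] {f : ℝ → E}
    (hf : IntervalIntegrable f volume t T) {s : ℝ} (hs : s ∈ Icc t T) :
    IntervalIntegrable f volume t s :=
  hf.mono_set (by
    rw [uIcc_of_le hs.1, uIcc_of_le (hs.1.trans hs.2)]
    exact Icc_subset_Icc_right hs.2)

theorem intervalIntegrable_of_continuousOn {E : Type*} [NormedAddCommGroup E] {f : ℝ → E}
    (htT : t ≤ T) (hf : ContinuousOn f (Icc t T)) : IntervalIntegrable f volume t T :=
  ContinuousOn.intervalIntegrable (by rwa [uIcc_of_le htT])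

theorem intervalIntegrable_inner_clm (htT : t ≤ T) {v : ℝ → V} (hv : IsControl t T v)
    (N : V →L[ℝ] V) : IntervalIntegrable (fun s => ⟪v s, N (v s)⟫_ℝ) volume t T := by
  rw [intervalIntegrable_iff_integrableOn_Ioc_of_le htT]
  have h1 : Integrable (fun s => ‖v s‖ ^ 2) (volume.restrict (Ioc t T)) :=
    (hv.integrable_norm_pow two_ne_zero)
  refine (h1.const_mul ‖N‖).mono'
    (hv.1.inner (N.continuous.comp_aestronglyMeasurable hv.1)) ?_
  refine Filter.Eventually.of_forall fun s => (norm_inner_le_norm _ _).trans ?_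
  calc _ ≤ ‖v s‖ * (‖N‖ * ‖v s‖) :=
        mul_le_mul_of_nonneg_left (N.le_opNorm _) (norm_nonneg _)
    _ = _ := by ring

theorem intervalIntegrable_inner_of_continuousOn (htT : t ≤ T) {z g : ℝ → H}
    (hz : ContinuousOn z (Icc t T)) (hg : IntervalIntegrable g volume t T) :
    IntervalIntegrable (fun s => ⟪z s, g s⟫_ℝ) volume t T := by
  rw [intervalIntegrable_iff_integrableOn_Ioc_of_le htT] at hg ⊢
  obtain ⟨C, hC⟩ := isCompact_Icc.exists_bound_of_continuousOn hz
  refine (hg.norm.const_mul C).mono'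
    (((hz.mono Ioc_subset_Icc_self).aestronglyMeasurable measurableSet_Ioc).inner hg.1) ?_
  filter_upwards [ae_restrict_mem measurableSet_Ioc] with s hs
  exact (norm_inner_le_norm _ _).trans
    (mul_le_mul_of_nonneg_right (hC s (Ioc_subset_Icc_self hs)) (norm_nonneg _))

end Integrability

section Optimality

variable {H V : Type*}
  [NormedAddCommGroup H] [InnerProductSpace ℝ H] [CompleteSpace H]
  [NormedAddCommGroup V] [InnerProductSpace ℝ V] [CompleteSpace V]
  {A : H → H} {F FT : H → ℝ} {B : V →L[ℝ] H} {N : V ≃L[ℝ] V}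
  {γ b ν M νT MT m k T t : ℝ} {x : H}

theorem exists_unique_isState (P : Hypotheses A F FT B N γ b ν M νT MT m k T) (htT : t ≤ T)
    {v : ℝ → V} (hv : IsControl t T v) :
    ∃ ξ : ℝ → H, IsState A B t T x v ξ ∧
      ∀ ξ' : ℝ → H, IsState A B t T x v ξ' → EqOn ξ' ξ (Icc t T) := by
  have hLip : LipschitzWith (Real.toNNReal γ) A := by
    refine LipschitzWith.of_dist_le_mul fun x y => ?_
    rw [Real.coe_toNNReal _ P.γ_nonneg, dist_eq_norm, dist_eq_norm]
    exact P.norm_A_sub_le x y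
  have hBv := intervalIntegrable_clm_comp B (hv.intervalIntegrable htT)
  have hg : ContinuousOn (fun s => x + ∫ τ in t..s, B (v τ)) (Icc t T) := by
    have := intervalIntegral.continuousOn_primitive_interval' hBv left_mem_uIcc
    rw [uIcc_of_le htT] at this
    exact continuousOn_const.add this
  have hsplit (ξ : ℝ → H) (hξ : ContinuousOn ξ (Icc t T)) (s : ℝ) (hs : s ∈ Icc t T) :
      x + ∫ τ in t..s, (A (ξ τ) + B (v τ))
        = (x + ∫ τ in t..s, B (v τ)) + ∫ τ in t..s, A (ξ τ) := by
    have hAi : IntervalIntegrable (fun τ => A (ξ τ)) volume t s :=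
      intervalIntegrable_of_continuousOn hs.1
        (P.continuous_A.comp_continuousOn (hξ.mono (Icc_subset_Icc_right hs.2)))
    rw [intervalIntegral.integral_add hAi (intervalIntegrable_mono_Icc hBv hs)]
    abel
  -- The control enters only through the continuous inhomogeneity `x + ∫ B v`.
  obtain ⟨ξ, ⟨hc, h⟩, huniq⟩ := exists_unique_volterra htT hLip hg
  refine ⟨ξ, ⟨hc.continuousOn, fun s hs => ?_⟩, fun ξ' h' => huniq ξ' h'.1 fun s hs => ?_⟩
  · rw [hsplit ξ hc.continuousOn s hs]
    exact h s hs
  · rw [← hsplit ξ' h'.1 s hs]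
    exact h'.2 s hs

/-- The payoff may be computed with any solution of the state equation in place of the chosen
one. -/
theorem payoff_eq (P : Hypotheses A F FT B N γ b ν M νT MT m k T) (htT : t ≤ T)
    {v : ℝ → V} (hv : IsControl t T v) {ξ : ℝ → H} (hξ : IsState A B t T x v ξ) :
    payoff A B N F FT t T x v = (∫ s in t..T, F (ξ s)) + FT (ξ T)
      + 1 / 2 * ∫ s in t..T, ⟪v s, N (v s)⟫_ℝ := by
  obtain ⟨ξ₀, h₀, huniq⟩ := exists_unique_isState (x := x) P htT hv
  have hst : IsState A B t T x v (state A B t T x v) := Classical.epsilon_spec ⟨ξ₀, h₀⟩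
  have he : EqOn (state A B t T x v) ξ (Icc t T) :=
    (huniq _ hst).trans (huniq _ hξ).symm
  rw [payoff, he (right_mem_Icc.2 htT)]
  congr 2
  refine intervalIntegral.integral_congr fun s hs => ?_
  rw [uIcc_of_le htT] at hs
  simp only [he hs]

theorem gain_apply (B : V →L[ℝ] H) (N : V ≃L[ℝ] V) (z : H) :
    gain B N z = B (N.symm (ContinuousLinearMap.adjoint B z)) := rfl

theorem IsFBSolution.isState_feedback (P : Hypotheses A F FT B N γ b ν M νT MT m k T)
    {y z : ℝ → H} (S : IsFBSolution A B N F FT t T x y z) :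
    IsState A B t T x (feedback B N z) y := by
  refine ⟨S.continuousOn_y, fun s hs => ?_⟩
  have := S.integral_forward P le_rfl hs.1 hs.2
  simp only [feedback, map_neg, ← gain_apply, ← sub_eq_add_neg]
  rw [this, S.initial]
  abel

theorem IsFBSolution.isControl_feedback {y z : ℝ → H}
    (S : IsFBSolution A B N F FT t T x y z) : IsControl t T (feedback B N z) :=
  isControl_of_continuousOn ((N.symm.continuous.comp
    (ContinuousLinearMap.adjoint B).continuous).comp_continuousOn S.continuousOn_z).neg

theorem inner_symm_of_isSelfAdjoint {N : V →L[ℝ] V} (hN : IsSelfAdjoint N) (v w : V) :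
    ⟪v, N w⟫_ℝ = ⟪w, N v⟫_ℝ := by
  rw [real_inner_comm (N v) w]
  exact (hN.isSymmetric v w).symm

/-- A nonnegative invertible self-adjoint operator is definite, by the Cauchy-Schwarz inequality
for its form, applied to `N w` and `w`. -/
theorem eq_zero_of_inner_eq_zero (hNsa : IsSelfAdjoint (N : V →L[ℝ] V))
    (hNpos : ∀ v : V, 0 ≤ ⟪v, N v⟫_ℝ) {w : V} (hw : ⟪w, N w⟫_ℝ = 0) : w = 0 := by
  let L : LinearMap.BilinForm ℝ V := LinearMap.mk₂ ℝ (fun v w => ⟪v, N w⟫_ℝ)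
    (fun _ _ _ => inner_add_left _ _ _) (fun _ _ _ => real_inner_smul_left _ _ _)
    (fun _ _ _ => by rw [map_add, inner_add_right])
    (fun _ _ _ => by rw [map_smul, real_inner_smul_right]; rfl)
  have h := LinearMap.BilinForm.apply_sq_le_of_symm L hNpos
    ⟨fun v w => inner_symm_of_isSelfAdjoint hNsa v w⟩ (N w) w
  simp only [L, LinearMap.mk₂_apply, hw, mul_zero, real_inner_self_eq_norm_sq] at h
  have h2 : ‖N w‖ = 0 := by
    by_contra h3
    have : 0 < (‖N w‖ ^ 2) ^ 2 := by positivity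
    linarith
  exact N.map_eq_zero_iff.1 (norm_eq_zero.1 h2)

/-- A pointwise convexity inequality: the running cost at `(ξ, v)`, corrected by the terms that
integration by parts turns into a boundary term, exceeds the running cost at `(y, u)` at least by
the control energy of `v - u`. Here the convexity of `F` absorbs the second-order remainder of `A`,
since `|z| ≤ a |y|` with `b a < ν`. -/
theorem Hypotheses.cost_add_le (P : Hypotheses A F FT B N γ b ν M νT MT m k T)
    (hNsa : IsSelfAdjoint (N : V →L[ℝ] V)) (hT : 0 ≤ T) {ξ y z : H} {u v : V}
    (hz : ‖z‖ ≤ alpha γ M νT MT k T 0 * ‖y‖)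
    (hu : N u = -ContinuousLinearMap.adjoint B z) :
    F y + 1 / 2 * ⟪u, N u⟫_ℝ + 1 / 2 * ⟪v - u, N (v - u)⟫_ℝ
      ≤ F ξ + 1 / 2 * ⟪v, N v⟫_ℝ
        + (⟪z, (A ξ + B v) - (A y + B u)⟫_ℝ + ⟪costateField A F y z, ξ - y⟫_ℝ) := by
  have h1 := add_inner_gradient_add_le P.contDiff_F (fun x ξ => (P.hessian_F x ξ).1) y ξ
  have h2 := (abs_le.1 (P.inner_taylor_le (alpha_nonneg P.k_pos P.νT_pos hT) (x := ξ) hz)).1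
  have h3 : ⟪v - u, N (v - u)⟫_ℝ
      = ⟪v, N v⟫_ℝ - ⟪u, N u⟫_ℝ + 2 * ⟪z, B (v - u)⟫_ℝ := by
    have h4 : ⟪u, N v⟫_ℝ = ⟪v, N u⟫_ℝ := inner_symm_of_isSelfAdjoint hNsa _ _
    have h5 : ⟪z, B (v - u)⟫_ℝ = -⟪v - u, N u⟫_ℝ := by
      rw [hu, inner_neg_right, ContinuousLinearMap.adjoint_inner_right, neg_neg, real_inner_comm]
    rw [h5, map_sub]
    simp only [inner_sub_left, inner_sub_right]
    rw [h4]
    ring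
  have h6 : ⟪z, (A ξ + B v) - (A y + B u)⟫_ℝ + ⟪costateField A F y z, ξ - y⟫_ℝ
      = ⟪A ξ - A y - fderiv ℝ A y (ξ - y), z⟫_ℝ + ⟪z, B (v - u)⟫_ℝ
        - ⟪gradient F y, ξ - y⟫_ℝ := by
    have e : (A ξ + B v) - (A y + B u) = (A ξ - A y) + B (v - u) := by
      rw [map_sub]
      abel
    rw [e, costateField, inner_neg_left, inner_add_left, inner_add_right,
      ContinuousLinearMap.adjoint_inner_left, inner_sub_left _ _ z,
      real_inner_comm (A ξ - A y) z, real_inner_comm (fderiv ℝ A y _) z]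
    ring
  have h7 := mul_nonneg P.alpha_lt.le (sq_nonneg ‖ξ - y‖)
  rw [h6, h3]
  linarith

/-- The payoff exceeds its value at the feedback control `u` by at least the control energy of the
deviation `v - u`. The first-order terms cancel by integration by parts. -/
theorem IsFBSolution.payoff_feedback_add_le (P : Hypotheses A F FT B N γ b ν M νT MT m k T)
    (hNsa : IsSelfAdjoint (N : V →L[ℝ] V)) (ht : 0 ≤ t) (htT : t ≤ T)
    {y z : ℝ → H} (S : IsFBSolution A B N F FT t T x y z) {v : ℝ → V} (hv : IsControl t T v) :
    payoff A B N F FT t T x (feedback B N z)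
      + 1 / 2 * ∫ s in t..T, ⟪v s - feedback B N z s, N (v s - feedback B N z s)⟫_ℝ
      ≤ payoff A B N F FT t T x v := by
  set u := feedback B N z with hu
  have huc : IsControl t T u := S.isControl_feedback
  have hus : IsState A B t T x u y := S.isState_feedback P
  obtain ⟨ξ, hξ, -⟩ := exists_unique_isState (x := x) P htT hv
  rw [payoff_eq P htT huc hus, payoff_eq P htT hv hξ]
  have hwc : IsControl t T (fun s => v s - u s) := MemLp.sub hv huc
  have hAξ : ContinuousOn (fun s => A (ξ s)) (Icc t T) := P.continuous_A.comp_continuousOn hξ.1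
  have hAy : ContinuousOn (fun s => A (y s)) (Icc t T) := P.continuous_A.comp_continuousOn hus.1
  have hBv := intervalIntegrable_clm_comp B (hv.intervalIntegrable htT)
  have hBu := intervalIntegrable_clm_comp B (huc.intervalIntegrable htT)
  have hfv : IntervalIntegrable (fun s => A (ξ s) + B (v s)) volume t T :=
    (intervalIntegrable_of_continuousOn htT hAξ).add hBv
  have hfu : IntervalIntegrable (fun s => A (y s) + B (u s)) volume t T :=
    (intervalIntegrable_of_continuousOn htT hAy).add hBu
  set g : ℝ → H := fun s => (A (ξ s) + B (v s)) - (A (y s) + B (u s)) with hg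
  have hgi : IntervalIntegrable g volume t T := hfv.sub hfu
  have hη (s : ℝ) (hs : s ∈ Icc t T) : ∫ τ in t..s, g τ = ξ s - y s := by
    rw [hg, intervalIntegral.integral_sub (intervalIntegrable_mono_Icc hfv hs)
      (intervalIntegrable_mono_Icc hfu hs), hξ.2 s hs, hus.2 s hs]
    abel
  have hhc := S.continuousOn_costateField P
  have hparts := integral_inner_primitive
    (h := fun s => costateField A F (y s) (z s)) htT S.continuousOn_z hhc
    (fun s hs => S.backward s hs) hgi
  have hparts' : ∫ s in t..T, ⟪costateField A F (y s) (z s), ∫ τ in t..s, g τ⟫_ℝ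
      = ∫ s in t..T, ⟪costateField A F (y s) (z s), ξ s - y s⟫_ℝ := by
    refine intervalIntegral.integral_congr fun s hs => ?_
    rw [uIcc_of_le htT] at hs
    simp only [hη s hs]
  rw [hη T (right_mem_Icc.2 htT), hparts'] at hparts
  have hFξ : IntervalIntegrable (fun s => F (ξ s)) volume t T :=
    intervalIntegrable_of_continuousOn htT (P.contDiff_F.continuous.comp_continuousOn hξ.1)
  have hFy : IntervalIntegrable (fun s => F (y s)) volume t T :=
    intervalIntegrable_of_continuousOn htT (P.contDiff_F.continuous.comp_continuousOn hus.1)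
  have hNv := intervalIntegrable_inner_clm htT hv (N : V →L[ℝ] V)
  have hNu := intervalIntegrable_inner_clm htT huc (N : V →L[ℝ] V)
  have hNw := intervalIntegrable_inner_clm htT hwc (N : V →L[ℝ] V)
  have hzg := intervalIntegrable_inner_of_continuousOn htT S.continuousOn_z hgi
  have hhη : IntervalIntegrable (fun s => ⟪costateField A F (y s) (z s), ξ s - y s⟫_ℝ) volume t T :=
    intervalIntegrable_of_continuousOn htT (hhc.inner (𝕜 := ℝ) (hξ.1.sub hus.1))
  simp only [ContinuousLinearEquiv.coe_coe] at hNv hNu hNw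
  have hpoint (s : ℝ) (hs : s ∈ Icc t T) :=
    P.cost_add_le hNsa (ht.trans htT) (ξ := ξ s) (u := u s) (v := v s) (S.norm_costate_le P ht hs)
      (by simp [hu, feedback])
  have hint := intervalIntegral.integral_mono_on htT
    ((hFy.add (hNu.const_mul (1 / 2))).add (hNw.const_mul (1 / 2)))
    ((hFξ.add (hNv.const_mul (1 / 2))).add (hzg.add hhη)) hpoint
  rw [intervalIntegral.integral_add (hFy.add (hNu.const_mul (1 / 2))) (hNw.const_mul (1 / 2)),
    intervalIntegral.integral_add hFy (hNu.const_mul (1 / 2)),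
    intervalIntegral.integral_add (hFξ.add (hNv.const_mul (1 / 2))) (hzg.add hhη),
    intervalIntegral.integral_add hFξ (hNv.const_mul (1 / 2)),
    intervalIntegral.integral_add hzg hhη, hparts] at hint
  simp only [intervalIntegral.integral_const_mul] at hint
  have hterm := add_inner_gradient_add_le P.contDiff_FT (fun x ξ => (P.hessian_FT x ξ).1)
    (y T) (ξ T)
  rw [← S.terminal] at hterm
  have : 0 ≤ νT / 2 * ‖ξ T - y T‖ ^ 2 := by
    have := P.νT_pos
    positivity
  linarith

end Optimality

end HilbertControl

theorem mainTheorem3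
    {H V : Type*}
    [NormedAddCommGroup H] [InnerProductSpace ℝ H] [CompleteSpace H]
    [NormedAddCommGroup V] [InnerProductSpace ℝ V] [CompleteSpace V]
    (A : H → H) (F FT : H → ℝ) (B : V →L[ℝ] H) (N : V ≃L[ℝ] V)
    (γ b ν M νT MT m k T t : ℝ)
    -- the drift
    (hA0 : A 0 = 0)
    (hA1 : ContDiff ℝ 1 A)
    (hA2 : Differentiable ℝ (fderiv ℝ A))
    (hAγ : ∀ x, ‖fderiv ℝ A x‖ ≤ γ)
    (hAb : ∀ x₁ x₂, ‖fderiv ℝ A x₁ - fderiv ℝ A x₂‖ ≤ b * ‖x₁ - x₂‖ / (1 + max ‖x₁‖ ‖x₂‖))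
    -- the running and the terminal cost
    (hν : 0 < ν) (hνT : 0 < νT)
    (hF : ContDiff ℝ 2 F) (hF0 : F 0 = 0) (hDF0 : gradient F 0 = 0)
    (hF2 : ∀ x ξ, ν * ‖ξ‖ ^ 2 ≤ fderiv ℝ (fderiv ℝ F) x ξ ξ ∧
      fderiv ℝ (fderiv ℝ F) x ξ ξ ≤ M * ‖ξ‖ ^ 2)
    (hFT : ContDiff ℝ 2 FT) (hFT0 : FT 0 = 0) (hDFT0 : gradient FT 0 = 0)
    (hFT2 : ∀ x ξ, νT * ‖ξ‖ ^ 2 ≤ fderiv ℝ (fderiv ℝ FT) x ξ ξ ∧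
      fderiv ℝ (fderiv ℝ FT) x ξ ξ ≤ MT * ‖ξ‖ ^ 2)
    -- the control operator and the control cost
    (hNsa : IsSelfAdjoint (N : V →L[ℝ] V))
    (hNpos : ∀ v : V, 0 ≤ ⟪v, N v⟫_ℝ)
    (hm : 0 < m)
    (hBN : ∀ ξ : H, m * ‖ξ‖ ^ 2 ≤ ⟪HilbertControl.gain B N ξ, ξ⟫_ℝ)
    -- the restrictions on the constants
    (hk : 0 < k) (hk' : k < min m ν)
    (hbk : b ^ 2 / 16 < (m - k) * (ν - k))
    (hα : 0 < ν - b * HilbertControl.alpha γ M νT MT k T 0)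
    (hγM : γ ^ 2 < M * ‖HilbertControl.gain B N‖)
    -- the time interval and the initial state
    (ht : 0 ≤ t) (htT : t ≤ T) (x : H) :
    -- the state equation is well posed for every control
    (∀ v : ℝ → V, HilbertControl.IsControl t T v →
      ∃ ξ : ℝ → H, HilbertControl.IsState A B t T x v ξ ∧
        ∀ ξ' : ℝ → H, HilbertControl.IsState A B t T x v ξ' → EqOn ξ' ξ (Icc t T)) ∧
    -- the forward-backward system has exactly one solution, and it gives the optimal control
    ∃ y z : ℝ → H, HilbertControl.IsFBSolution A B N F FT t T x y z ∧
      (∀ y' z' : ℝ → H, HilbertControl.IsFBSolution A B N F FT t T x y' z' →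
        EqOn y' y (Icc t T) ∧ EqOn z' z (Icc t T)) ∧
      HilbertControl.IsOptimalControl A B N F FT t T x (HilbertControl.feedback B N z) ∧
      ∀ v : ℝ → V, HilbertControl.IsOptimalControl A B N F FT t T x v →
        v =ᵐ[volume.restrict (Ioc t T)] HilbertControl.feedback B N z := by
  -- The strict inequality `γ² < M ‖B N⁻¹ B*‖` forces the state space to be nonzero, and this gives
  -- the signs of the constants.
  obtain ⟨ξ₀, hξ₀⟩ : ∃ ξ : H, 0 < ‖ξ‖ := by
    by_contra! h
    have h0 : HilbertControl.gain B N = 0 := by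
      ext ξ
      rw [norm_le_zero_iff.1 (h ξ), map_zero, map_zero]
    rw [h0, norm_zero, mul_zero] at hγM
    linarith [sq_nonneg γ]
  have hξ₀2 : 0 < ‖ξ₀‖ ^ 2 := by positivity
  have hM : 0 < M :=
    pos_of_mul_pos_left ((mul_pos hν hξ₀2).trans_le ((hF2 0 ξ₀).1.trans (hF2 0 ξ₀).2)) hξ₀2.le
  have hMT : 0 < MT :=
    pos_of_mul_pos_left ((mul_pos hνT hξ₀2).trans_le ((hFT2 0 ξ₀).1.trans (hFT2 0 ξ₀).2)) hξ₀2.le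
  have hb : 0 ≤ b := by
    have h := (norm_nonneg _).trans (hAb ξ₀ 0)
    rw [sub_zero] at h
    by_contra! hneg
    have : b * ‖ξ₀‖ / (1 + max ‖ξ₀‖ ‖(0 : H)‖) < 0 :=
      div_neg_of_neg_of_pos (mul_neg_of_neg_of_pos hneg hξ₀) (by positivity)
    linarith
  have P : HilbertControl.Hypotheses A F FT B N γ b ν M νT MT m k T :=
    ⟨hA0, hA1, hAγ, hAb, hb, hF, hDF0, hF2, hν, hM.le, hFT, hDFT0, hFT2, hνT, hMT, hm, hBN, hk,
      (lt_min_iff.1 hk').1, hbk, hα⟩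
  refine ⟨fun v hv => HilbertControl.exists_unique_isState P htT hv, ?_⟩
  obtain ⟨y, z, hyz, hx⟩ :=
    HilbertControl.exists_isFBSolution_through P (ht.trans htT) ⟨ht, htT⟩ x
  have S : HilbertControl.IsFBSolution A B N F FT t T x y z := by
    have := hyz.restrict ht
    rwa [hx] at this
  have hopt (v : ℝ → V) (hv : HilbertControl.IsControl t T v) :=
    S.payoff_feedback_add_le P hNsa ht htT hv
  have hnonneg (v : ℝ → V) : 0 ≤ ∫ s in t..T, ⟪v s - HilbertControl.feedback B N z s,
      N (v s - HilbertControl.feedback B N z s)⟫_ℝ :=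
    intervalIntegral.integral_nonneg htT fun s _ => hNpos _
  refine ⟨y, z, S, fun y' z' S' => S'.unique P S ht htT,
    ⟨S.isControl_feedback, fun v hv => by linarith [hopt v hv, hnonneg v]⟩, fun v hv => ?_⟩
  have h0 : ∫ s in t..T, ⟪v s - HilbertControl.feedback B N z s,
      N (v s - HilbertControl.feedback B N z s)⟫_ℝ = 0 := by
    have h1 := hv.2 _ S.isControl_feedback
    linarith [hopt v hv.1, hnonneg v]
  have hw : HilbertControl.IsControl t T fun s => v s - HilbertControl.feedback B N z s :=
    MemLp.sub hv.1 S.isControl_feedback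
  have hi := HilbertControl.intervalIntegrable_inner_clm htT hw (N : V →L[ℝ] V)
  simp only [ContinuousLinearEquiv.coe_coe] at hi
  rw [intervalIntegral.integral_of_le htT, integral_eq_zero_iff_of_nonneg (fun s => hNpos _)
    ((intervalIntegrable_iff_integrableOn_Ioc_of_le htT).1 hi)] at h0
  filter_upwards [h0] with s hs
  exact sub_eq_zero.1 (HilbertControl.eq_zero_of_inner_eq_zero hNsa hNpos hs)
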